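/- Let $I(x,y,z)=x^2+y^2+z^2-2xyz-1$ and let $$\mathcal G=\{F\in\mathbb Z[x,y,z]^3 \;:\; I(F(x,y,z))=I(x,y,z)\ \text{and}\ F(1,1,1)=(1,1,1)\}.$$ Under composition of mappings $\mathcal G$ is a group (every $F\in\mathcal G$ is invertible in $\mathcal G$). Call $F\in\mathcal G$ reversible if $G\circ F\circ G^{-1}=F^{-1}$ for some $G\in\mathcal G$, and truly reversible if moreover $F^2\ne \mathrm{Id}$. Let $\mathcal R_{\mathcal G}(F)$ be the group of all $G\in\mathcal G$ with $G\circ F\circ G^{-1}\in\{F,F^{-1}\}$. Write $C_\infty\cong\mathbb Z$ for the infinite cyclic group, $D_n$ for the dihedral group of order $2n$, and $D_\infty$ for the infinite dihedral group; $D_2\cong C_2\times C_2$. **Theorem.** Let $F\in\mathcal G$. Up to isomorphism, $\mathcal R_{\mathcal G}(F)$ is one of $C_\infty$, $\mathcal G$, $D_2$, $D_3$, $D_\infty$, and the following five cases are exhaustive: 1. $\mathcal R_{\mathcal G}(F)\cong C_\infty$ if and only if $F$ is not reversible; 2. $\mathcal R_{\mathcal G}(F)=\mathcal G$ if and only if $F=\mathrm{Id}$,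 and also $\mathcal R_{\mathcal G}(F)\cong\mathcal G$ if and only if $F=\mathrm{Id}$; 3. $\mathcal R_{\mathcal G}(F)\cong D_2\cong C_2\times C_2$ if and only if $F^2=\mathrm{Id}\neq F$; 4. $\mathcal R_{\mathcal G}(F)\cong D_3$ if and only if $F^3=\mathrm{Id}\neq F$; 5. $\mathcal R_{\mathcal G}(F)\cong D_\infty$ if $F$ is truly reversible and not of finite order. In particular, every element of finite order of $\mathcal G$ is reversible. -/

import Mathlib

open MvPolynomial

/-- A polynomial mapping of 3-space with integer coefficients, i.e. an element of `ℤ[x,y,z]³`. -/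
@[ext] structure PolyMap where
  /-- the three component polynomials -/
  coord : Fin 3 → MvPolynomial (Fin 3) ℤ

namespace PolyMap

/-- The identity mapping `(x, y, z)`. -/
noncomputable instance : One PolyMap := ⟨⟨X⟩⟩

/-- Composition of mappings: the `i`-th component of `F * G = F ∘ G` is `Fᵢ(G₁, G₂, G₃)`. -/
noncomputable instance : Mul PolyMap := ⟨fun F G => ⟨fun i => bind₁ G.coord (F.coord i)⟩⟩

theorem one_coord : (1 : PolyMap).coord = X := rfl

theorem mul_coord (F G : PolyMap) (i : Fin 3) :
    (F * G).coord i = bind₁ G.coord (F.coord i) := rfl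

theorem bind₁_mul (F G : PolyMap) (p : MvPolynomial (Fin 3) ℤ) :
    bind₁ (F * G).coord p = bind₁ G.coord (bind₁ F.coord p) :=
  (bind₁_bind₁ F.coord G.coord p).symm

noncomputable instance : Monoid PolyMap where
  mul_assoc F G H := by
    ext1; funext i
    exact bind₁_bind₁ G.coord H.coord (F.coord i)
  one_mul F := by
    ext1; funext i
    exact bind₁_X_right F.coord i
  mul_one F := by
    ext1; funext i
    show bind₁ X (F.coord i) = F.coord i
    rw [bind₁_X_left]; rfl

end PolyMap

/-- The Fricke-Vogt invariant `I(x, y, z) = x² + y² + z² - 2xyz - 1`. -/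
noncomputable def frickeVogt : MvPolynomial (Fin 3) ℤ :=
  X 0 ^ 2 + X 1 ^ 2 + X 2 ^ 2 - 2 * X 0 * X 1 * X 2 - 1

/-- The set of all `F ∈ ℤ[x,y,z]³` with `I(F(x,y,z)) = I(x,y,z)` and `F(1,1,1) = (1,1,1)`,
as a monoid under composition. -/
noncomputable def nielsenMaps : Submonoid PolyMap where
  carrier := {F | bind₁ F.coord frickeVogt = frickeVogt ∧
    ∀ i, eval (fun _ => (1 : ℤ)) (F.coord i) = 1}
  one_mem' := ⟨by rw [PolyMap.one_coord, bind₁_X_left]; rfl, fun i => eval_X i⟩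
  mul_mem' := by
    rintro F G ⟨hF, hF'⟩ ⟨hG, hG'⟩
    refine ⟨by rw [PolyMap.bind₁_mul, hF, hG], fun i => ?_⟩
    rw [PolyMap.mul_coord, eval, eval₂Hom_bind₁]
    have h : (fun j => eval₂Hom (RingHom.id ℤ) (fun _ => (1 : ℤ)) (G.coord j)) = fun _ => 1 :=
      funext hG'
    rw [h]
    exact hF' i

/-- The group of invertible elements of `nielsenMaps` under composition. -/
abbrev NielsenGroup : Type := nielsenMapsˣ

/-- `F` is reversible within the group `Γ`: some `G ∈ Γ` satisfies `G ∘ F ∘ G⁻¹ = F⁻¹`. -/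
def IsReversible {Γ : Type*} [Group Γ] (F : Γ) : Prop :=
  ∃ G : Γ, G * F * G⁻¹ = F⁻¹

/-- `F` is truly reversible: it is reversible and `F² ≠ Id`. -/
def IsTrulyReversible {Γ : Type*} [Group Γ] (F : Γ) : Prop :=
  IsReversible F ∧ F ^ 2 ≠ 1

/-- The reversing symmetry group of `F` within `Γ`: all symmetries (`G ∘ F ∘ G⁻¹ = F`) and
reversing symmetries (`G ∘ F ∘ G⁻¹ = F⁻¹`) of `F` in `Γ`. -/
def reversingSymmetryGroup {Γ : Type*} [Group Γ] (F : Γ) : Subgroup Γ where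
  carrier := {G | G * F * G⁻¹ = F ∨ G * F * G⁻¹ = F⁻¹}
  one_mem' := Or.inl (by group)
  mul_mem' := by
    intro G H hG hH
    have e : G * H * F * (G * H)⁻¹ = G * (H * F * H⁻¹) * G⁻¹ := by group
    have e' : G * F⁻¹ * G⁻¹ = (G * F * G⁻¹)⁻¹ := by group
    show G * H * F * (G * H)⁻¹ = F ∨ G * H * F * (G * H)⁻¹ = F⁻¹
    rw [e]
    rcases hH with h | h <;> rw [h]
    · exact hG
    · rw [e']
      rcases hG with h' | h' <;> rw [h']
      · exact Or.inr rfl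
      · exact Or.inl (inv_inv F)
  inv_mem' := by
    intro G hG
    show G⁻¹ * F * G⁻¹⁻¹ = F ∨ G⁻¹ * F * G⁻¹⁻¹ = F⁻¹
    rcases hG with h | h
    · left
      calc G⁻¹ * F * G⁻¹⁻¹ = G⁻¹ * (G * F * G⁻¹) * G⁻¹⁻¹ := by rw [h]
        _ = F := by group
    · right
      calc G⁻¹ * F * G⁻¹⁻¹ = G⁻¹ * (F⁻¹)⁻¹ * G⁻¹⁻¹ := by rw [inv_inv F]
        _ = G⁻¹ * (G * F * G⁻¹)⁻¹ * G⁻¹⁻¹ := by rw [h]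
        _ = F⁻¹ := by group

/-- The cyclic group `C₂`. -/
abbrev CyclicTwo : Type := Multiplicative (ZMod 2)

/-- The infinite cyclic group `C_∞`. -/
abbrev CyclicInf : Type := Multiplicative ℤ

/-- The infinite dihedral group `D_∞`, the semidirect product of `ℤ = ZMod 0` with `C₂`. -/
abbrev DihedralInf : Type := DihedralGroup 0

/-! The group is `GL(2, ℤ)` modulo `±1`, so the theorem becomes a statement about conjugacy and
centralizers of integer 2×2 matrices up to sign.

Generation comes from a descent on degrees, as for the Markov equation. With two components g, h
fixed, the equation is quadratic in the third component f, and its other root is 2gh - f. Unless all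
components have degree at most one, replacing a component of largest degree strictly lowers that
degree (`totalDegree_vieta_lt`). The descent ends at linear solutions, which are permutations of the
coordinates. Hence every map in the defining set is a product of Vieta involutions and permutations,
and in particular is invertible.

The addition formula for cosh shows that these generators move the points (cosh a, cosh b,
cosh(a+b)) as integer matrices move (a, b). Every matrix occurs (`realised_eq_top`), and a matrix
acts trivially on the points only if it is `±1`. Conversely, an element fixing all these points is
the identity (`eq_one_of_actsAs_one`): by ping-pong, an element other than a permutation sends two
of three disjoint regions into one. This gives the surjection `ofGL` with kernel `±1`.

The classification then goes by trace and determinant. Trace 0 gives involutions, and trace ±1 with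
determinant 1 gives order three. In both cases reduction under conjugation leaves explicit models
whose centralizers are computed entry by entry. Trace ±2 with determinant 1 gives the identity or a
unipotent element. In all other cases the discriminant is positive and not a square, and the
logarithm of an eigenvalue embeds the centralizer modulo sign as a discrete subgroup of ℝ
(`hasCyclicCentralizer_of_not_isSquare`). Infinite-order elements therefore have cyclic
centralizers, and a reverser, if there is one, extends the centralizer to `D_∞`. -/

/-! ### Linear solutions of the invariant equation -/

/-- The hypotheses are the x³, x²y, x²z and xyz coefficients of a product of three linear forms. If
exactly one of the three x-coefficients vanished, the next two equations would kill the rest of that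
linear part, and the permanent could not be 1. -/
theorem two_eq_zero_of_column {p₁ q₁ r₁ p₂ q₂ r₂ p₃ q₃ r₃ : ℤ} (e₁ : p₁ * q₁ * r₁ = 0)
    (e₂ : p₁ * q₁ * r₂ + p₁ * q₂ * r₁ + p₂ * q₁ * r₁ = 0)
    (e₃ : p₁ * q₁ * r₃ + p₁ * q₃ * r₁ + p₃ * q₁ * r₁ = 0)
    (e₄ : p₁ * q₂ * r₃ + p₁ * q₃ * r₂ + p₂ * q₁ * r₃ + p₂ * q₃ * r₁ + p₃ * q₁ * r₂
      + p₃ * q₂ * r₁ = 1) :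
    (q₁ = 0 ∧ r₁ = 0) ∨ (p₁ = 0 ∧ r₁ = 0) ∨ (p₁ = 0 ∧ q₁ = 0) := by
  rcases mul_eq_zero.1 e₁ with e | rfl
  · rcases mul_eq_zero.1 e with rfl | rfl
    · by_cases hq : q₁ = 0
      · simp [hq]
      · by_cases hr : r₁ = 0
        · simp [hr]
        · have : p₂ = 0 := by simpa [hq, hr] using e₂
          have : p₃ = 0 := by simpa [hq, hr] using e₃
          simp_all
    · by_cases hq : p₁ = 0
      · simp [hq]
      · by_cases hr : r₁ = 0
        · simp [hr]
        · have : q₂ = 0 := by simpa [hq, hr] using e₂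
          have : q₃ = 0 := by simpa [hq, hr] using e₃
          simp_all
  · by_cases hq : q₁ = 0
    · simp [hq]
    · by_cases hr : p₁ = 0
      · simp [hr]
      · have : r₂ = 0 := by simpa [hq, hr] using e₂
        have : r₃ = 0 := by simpa [hq, hr] using e₃
        simp_all

theorem eq_zero_of_mul_eq_one {p q r p₀ q₀ r₀ : ℤ} (e : p * q * r = 1) (e₁ : p₀ * (q * r) = 0)
    (e₂ : q₀ * (p * r) = 0) (e₃ : r₀ * (p * q) = 0) : p₀ = 0 ∧ q₀ = 0 ∧ r₀ = 0 := by
  refine ⟨?_, ?_, ?_⟩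
  · linear_combination p * e₁ - p₀ * e
  · linear_combination q * e₂ - q₀ * e
  · linear_combination r * e₃ - r₀ * e

theorem cubic_coeffs_of_linear_solution {a₀ a₁ a₂ a₃ b₀ b₁ b₂ b₃ c₀ c₁ c₂ c₃ : ℤ}
    (h : ∀ x y z : ℤ, (a₀ + a₁ * x + a₂ * y + a₃ * z) ^ 2 + (b₀ + b₁ * x + b₂ * y + b₃ * z) ^ 2
      + (c₀ + c₁ * x + c₂ * y + c₃ * z) ^ 2
      - 2 * (a₀ + a₁ * x + a₂ * y + a₃ * z) * (b₀ + b₁ * x + b₂ * y + b₃ * z)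
        * (c₀ + c₁ * x + c₂ * y + c₃ * z) - 1 = x ^ 2 + y ^ 2 + z ^ 2 - 2 * x * y * z - 1) :
    (a₁ * b₁ * c₁ = 0) ∧
    (a₂ * b₂ * c₂ = 0) ∧
    (a₃ * b₃ * c₃ = 0) ∧
    (a₁ * b₂ * c₃ + a₁ * b₃ * c₂ + a₂ * b₁ * c₃ + a₂ * b₃ * c₁ + a₃ * b₁ * c₂
      + a₃ * b₂ * c₁ = 1) ∧
    (a₁ * b₁ * c₂ + a₁ * b₂ * c₁ + a₂ * b₁ * c₁ = 0) ∧
    (a₁ * b₁ * c₃ + a₁ * b₃ * c₁ + a₃ * b₁ * c₁ = 0) ∧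
    (a₂ * b₂ * c₁ + a₂ * b₁ * c₂ + a₁ * b₂ * c₂ = 0) ∧
    (a₂ * b₂ * c₃ + a₂ * b₃ * c₂ + a₃ * b₂ * c₂ = 0) ∧
    (a₃ * b₃ * c₁ + a₃ * b₁ * c₃ + a₁ * b₃ * c₃ = 0) ∧
    (a₃ * b₃ * c₂ + a₃ * b₂ * c₃ + a₂ * b₃ * c₃ = 0) ∧
    (a₀ * (b₁ * c₂ + b₂ * c₁) + b₀ * (a₁ * c₂ + a₂ * c₁) + c₀ * (a₁ * b₂ + a₂ * b₁)
      = a₁ * a₂ + b₁ * b₂ + c₁ * c₂) ∧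
    (a₀ * (b₁ * c₃ + b₃ * c₁) + b₀ * (a₁ * c₃ + a₃ * c₁) + c₀ * (a₁ * b₃ + a₃ * b₁)
      = a₁ * a₃ + b₁ * b₃ + c₁ * c₃) ∧
    (a₀ * (b₂ * c₃ + b₃ * c₂) + b₀ * (a₂ * c₃ + a₃ * c₂) + c₀ * (a₂ * b₃ + a₃ * b₂)
      = a₂ * a₃ + b₂ * b₃ + c₂ * c₃) := by
  have cancel : ∀ {n : ℤ} (m : ℤ), m ≠ 0 → m * n = 0 → n = 0 := fun m hm e =>
    (mul_eq_zero.1 e).resolve_left hm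
  -- Coefficients are isolated by finite differences. Each cubic one carries the factor -2 of the
  -- invariant: a third difference gives 6·2 up to sign, the signed sum over the cube {±1}³ gives
  -- 8·2, and a mixed difference for x²y gives 4·2.
  have x3 : a₁ * b₁ * c₁ = 0 := cancel 12 (by norm_num) (by
    linear_combination -h 2 0 0 + 3 * h 1 0 0 - 3 * h 0 0 0 + h (-1) 0 0)
  have y3 : a₂ * b₂ * c₂ = 0 := cancel 12 (by norm_num) (by
    linear_combination -h 0 2 0 + 3 * h 0 1 0 - 3 * h 0 0 0 + h 0 (-1) 0)
  have z3 : a₃ * b₃ * c₃ = 0 := cancel 12 (by norm_num) (by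
    linear_combination -h 0 0 2 + 3 * h 0 0 1 - 3 * h 0 0 0 + h 0 0 (-1))
  have perm : a₁ * b₂ * c₃ + a₁ * b₃ * c₂ + a₂ * b₁ * c₃ + a₂ * b₃ * c₁ + a₃ * b₁ * c₂
      + a₃ * b₂ * c₁ = 1 := by
    have : -16 * (a₁ * b₂ * c₃ + a₁ * b₃ * c₂ + a₂ * b₁ * c₃ + a₂ * b₃ * c₁ + a₃ * b₁ * c₂
      + a₃ * b₂ * c₁) = -16 := by
      linear_combination h 1 1 1 - h 1 1 (-1) - h 1 (-1) 1 - h (-1) 1 1 + h 1 (-1) (-1)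
        + h (-1) 1 (-1) + h (-1) (-1) 1 - h (-1) (-1) (-1)
    omega
  have xxy : a₁ * b₁ * c₂ + a₁ * b₂ * c₁ + a₂ * b₁ * c₁ = 0 := cancel (-8) (by norm_num) (by
    linear_combination h 1 1 0 + h (-1) 1 0 - 2 * h 0 1 0 - h 1 (-1) 0 - h (-1) (-1) 0
      + 2 * h 0 (-1) 0)
  have xxz : a₁ * b₁ * c₃ + a₁ * b₃ * c₁ + a₃ * b₁ * c₁ = 0 := cancel (-8) (by norm_num) (by
    linear_combination h 1 0 1 + h (-1) 0 1 - 2 * h 0 0 1 - h 1 0 (-1) - h (-1) 0 (-1)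
      + 2 * h 0 0 (-1))
  have yyx : a₂ * b₂ * c₁ + a₂ * b₁ * c₂ + a₁ * b₂ * c₂ = 0 := cancel (-8) (by norm_num) (by
    linear_combination h 1 1 0 + h 1 (-1) 0 - 2 * h 1 0 0 - h (-1) 1 0 - h (-1) (-1) 0
      + 2 * h (-1) 0 0)
  have yyz : a₂ * b₂ * c₃ + a₂ * b₃ * c₂ + a₃ * b₂ * c₂ = 0 := cancel (-8) (by norm_num) (by
    linear_combination h 0 1 1 + h 0 (-1) 1 - 2 * h 0 0 1 - h 0 1 (-1) - h 0 (-1) (-1)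
      + 2 * h 0 0 (-1))
  have zzx : a₃ * b₃ * c₁ + a₃ * b₁ * c₃ + a₁ * b₃ * c₃ = 0 := cancel (-8) (by norm_num) (by
    linear_combination h 1 0 1 + h 1 0 (-1) - 2 * h 1 0 0 - h (-1) 0 1 - h (-1) 0 (-1)
      + 2 * h (-1) 0 0)
  have zzy : a₃ * b₃ * c₂ + a₃ * b₂ * c₃ + a₂ * b₃ * c₃ = 0 := cancel (-8) (by norm_num) (by
    linear_combination h 0 1 1 + h 0 1 (-1) - 2 * h 0 1 0 - h 0 (-1) 1 - h 0 (-1) (-1)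
      + 2 * h 0 (-1) 0)
  have xy : a₀ * (b₁ * c₂ + b₂ * c₁) + b₀ * (a₁ * c₂ + a₂ * c₁) + c₀ * (a₁ * b₂ + a₂ * b₁)
      = a₁ * a₂ + b₁ * b₂ + c₁ * c₂ := by
    have := h 1 1 0
    have := h (-1) (-1) 0
    have := h 1 (-1) 0
    have := h (-1) 1 0
    linarith
  have xz : a₀ * (b₁ * c₃ + b₃ * c₁) + b₀ * (a₁ * c₃ + a₃ * c₁) + c₀ * (a₁ * b₃ + a₃ * b₁)
      = a₁ * a₃ + b₁ * b₃ + c₁ * c₃ := by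
    have := h 1 0 1
    have := h (-1) 0 (-1)
    have := h 1 0 (-1)
    have := h (-1) 0 1
    linarith
  have yz : a₀ * (b₂ * c₃ + b₃ * c₂) + b₀ * (a₂ * c₃ + a₃ * c₂) + c₀ * (a₂ * b₃ + a₃ * b₂)
      = a₂ * a₃ + b₂ * b₃ + c₂ * c₃ := by
    have := h 0 1 1
    have := h 0 (-1) (-1)
    have := h 0 1 (-1)
    have := h 0 (-1) 1
    linarith
  exact ⟨x3, y3, z3, perm, xxy, xxz, yyx, yyz, zzx, zzy, xy, xz, yz⟩

/-- Each column keeps one possibly nonzero entry. Permanent 1 puts these entries in distinct rows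
with product 1, the mixed quadratic coefficients then kill the constant terms, and the value at
(1,1,1) makes every entry 1. -/
theorem eq_perm_of_cubic_coeffs {a₀ a₁ a₂ a₃ b₀ b₁ b₂ b₃ c₀ c₁ c₂ c₃ : ℤ}
    (x3 : a₁ * b₁ * c₁ = 0)
    (y3 : a₂ * b₂ * c₂ = 0)
    (z3 : a₃ * b₃ * c₃ = 0)
    (perm : a₁ * b₂ * c₃ + a₁ * b₃ * c₂ + a₂ * b₁ * c₃ + a₂ * b₃ * c₁ + a₃ * b₁ * c₂
      + a₃ * b₂ * c₁ = 1)
    (xxy : a₁ * b₁ * c₂ + a₁ * b₂ * c₁ + a₂ * b₁ * c₁ = 0)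
    (xxz : a₁ * b₁ * c₃ + a₁ * b₃ * c₁ + a₃ * b₁ * c₁ = 0)
    (yyx : a₂ * b₂ * c₁ + a₂ * b₁ * c₂ + a₁ * b₂ * c₂ = 0)
    (yyz : a₂ * b₂ * c₃ + a₂ * b₃ * c₂ + a₃ * b₂ * c₂ = 0)
    (zzx : a₃ * b₃ * c₁ + a₃ * b₁ * c₃ + a₁ * b₃ * c₃ = 0)
    (zzy : a₃ * b₃ * c₂ + a₃ * b₂ * c₃ + a₂ * b₃ * c₃ = 0)
    (xy : a₀ * (b₁ * c₂ + b₂ * c₁) + b₀ * (a₁ * c₂ + a₂ * c₁) + c₀ * (a₁ * b₂ + a₂ * b₁)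
      = a₁ * a₂ + b₁ * b₂ + c₁ * c₂)
    (xz : a₀ * (b₁ * c₃ + b₃ * c₁) + b₀ * (a₁ * c₃ + a₃ * c₁) + c₀ * (a₁ * b₃ + a₃ * b₁)
      = a₁ * a₃ + b₁ * b₃ + c₁ * c₃)
    (yz : a₀ * (b₂ * c₃ + b₃ * c₂) + b₀ * (a₂ * c₃ + a₃ * c₂) + c₀ * (a₂ * b₃ + a₃ * b₂)
      = a₂ * a₃ + b₂ * b₃ + c₂ * c₃)
    (ha : a₀ + a₁ + a₂ + a₃ = 1) (hb : b₀ + b₁ + b₂ + b₃ = 1) (hc : c₀ + c₁ + c₂ + c₃ = 1) :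
    (a₀ = 0 ∧ b₀ = 0 ∧ c₀ = 0) ∧
    ((a₁ = 1 ∧ a₂ = 0 ∧ a₃ = 0 ∧ b₁ = 0 ∧ b₂ = 1 ∧ b₃ = 0 ∧ c₁ = 0 ∧ c₂ = 0 ∧ c₃ = 1) ∨
     (a₁ = 1 ∧ a₂ = 0 ∧ a₃ = 0 ∧ b₁ = 0 ∧ b₂ = 0 ∧ b₃ = 1 ∧ c₁ = 0 ∧ c₂ = 1 ∧ c₃ = 0) ∨
     (a₁ = 0 ∧ a₂ = 1 ∧ a₃ = 0 ∧ b₁ = 1 ∧ b₂ = 0 ∧ b₃ = 0 ∧ c₁ = 0 ∧ c₂ = 0 ∧ c₃ = 1) ∨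
     (a₁ = 0 ∧ a₂ = 1 ∧ a₃ = 0 ∧ b₁ = 0 ∧ b₂ = 0 ∧ b₃ = 1 ∧ c₁ = 1 ∧ c₂ = 0 ∧ c₃ = 0) ∨
     (a₁ = 0 ∧ a₂ = 0 ∧ a₃ = 1 ∧ b₁ = 1 ∧ b₂ = 0 ∧ b₃ = 0 ∧ c₁ = 0 ∧ c₂ = 1 ∧ c₃ = 0) ∨
     (a₁ = 0 ∧ a₂ = 0 ∧ a₃ = 1 ∧ b₁ = 0 ∧ b₂ = 1 ∧ b₃ = 0 ∧ c₁ = 1 ∧ c₂ = 0 ∧ c₃ = 0)) := by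
  rcases two_eq_zero_of_column x3 xxy xxz perm with ⟨rfl, rfl⟩ | ⟨rfl, rfl⟩ | ⟨rfl, rfl⟩ <;>
  rcases two_eq_zero_of_column y3 yyx yyz (by linear_combination perm) with ⟨rfl, rfl⟩ | ⟨rfl, rfl⟩ | ⟨rfl, rfl⟩ <;>
  rcases two_eq_zero_of_column z3 zzx zzy (by linear_combination perm) with ⟨rfl, rfl⟩ | ⟨rfl, rfl⟩ | ⟨rfl, rfl⟩ <;>
  simp only [mul_zero, zero_mul, add_zero, zero_add, zero_ne_one] at perm xy xz yz ha hb hc <;>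
  obtain ⟨rfl, rfl, rfl⟩ := eq_zero_of_mul_eq_one perm (by assumption) (by assumption) (by assumption) <;>
  simp_all

/-- Integer linear forms (with constant terms) that satisfy the equation of the Fricke-Vogt
invariant and have value `1` at `(1, 1, 1)` are a permutation of the coordinates. -/
theorem linear_solution_eq_perm {a₀ a₁ a₂ a₃ b₀ b₁ b₂ b₃ c₀ c₁ c₂ c₃ : ℤ}
    (h : ∀ x y z : ℤ, (a₀ + a₁ * x + a₂ * y + a₃ * z) ^ 2 + (b₀ + b₁ * x + b₂ * y + b₃ * z) ^ 2
      + (c₀ + c₁ * x + c₂ * y + c₃ * z) ^ 2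
      - 2 * (a₀ + a₁ * x + a₂ * y + a₃ * z) * (b₀ + b₁ * x + b₂ * y + b₃ * z)
        * (c₀ + c₁ * x + c₂ * y + c₃ * z) - 1 = x ^ 2 + y ^ 2 + z ^ 2 - 2 * x * y * z - 1)
    (ha : a₀ + a₁ + a₂ + a₃ = 1) (hb : b₀ + b₁ + b₂ + b₃ = 1) (hc : c₀ + c₁ + c₂ + c₃ = 1) :
    (a₀ = 0 ∧ b₀ = 0 ∧ c₀ = 0) ∧
    ((a₁ = 1 ∧ a₂ = 0 ∧ a₃ = 0 ∧ b₁ = 0 ∧ b₂ = 1 ∧ b₃ = 0 ∧ c₁ = 0 ∧ c₂ = 0 ∧ c₃ = 1) ∨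
     (a₁ = 1 ∧ a₂ = 0 ∧ a₃ = 0 ∧ b₁ = 0 ∧ b₂ = 0 ∧ b₃ = 1 ∧ c₁ = 0 ∧ c₂ = 1 ∧ c₃ = 0) ∨
     (a₁ = 0 ∧ a₂ = 1 ∧ a₃ = 0 ∧ b₁ = 1 ∧ b₂ = 0 ∧ b₃ = 0 ∧ c₁ = 0 ∧ c₂ = 0 ∧ c₃ = 1) ∨
     (a₁ = 0 ∧ a₂ = 1 ∧ a₃ = 0 ∧ b₁ = 0 ∧ b₂ = 0 ∧ b₃ = 1 ∧ c₁ = 1 ∧ c₂ = 0 ∧ c₃ = 0) ∨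
     (a₁ = 0 ∧ a₂ = 0 ∧ a₃ = 1 ∧ b₁ = 1 ∧ b₂ = 0 ∧ b₃ = 0 ∧ c₁ = 0 ∧ c₂ = 1 ∧ c₃ = 0) ∨
     (a₁ = 0 ∧ a₂ = 0 ∧ a₃ = 1 ∧ b₁ = 0 ∧ b₂ = 1 ∧ b₃ = 0 ∧ c₁ = 1 ∧ c₂ = 0 ∧ c₃ = 0)) := by
  obtain ⟨x3, y3, z3, perm, xxy, xxz, yyx, yyz, zzx, zzy, xy, xz, yz⟩ :=
    cubic_coeffs_of_linear_solution h
  exact eq_perm_of_cubic_coeffs x3 y3 z3 perm xxy xxz yyx yyz zzx zzy xy xz yz ha hb hc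

theorem MvPolynomial.eq_linear_of_totalDegree_le_one {R : Type*} [CommRing R]
    {f : MvPolynomial (Fin 3) R} (hf : f.totalDegree ≤ 1) :
    ∃ a₀ a₁ a₂ a₃ : R, f = C a₀ + C a₁ * X 0 + C a₂ * X 1 + C a₃ * X 2 := by
  refine ⟨coeff 0 f, coeff (Finsupp.single 0 1) f, coeff (Finsupp.single 1 1) f,
    coeff (Finsupp.single 2 1) f, ?_⟩
  ext m
  simp only [coeff_add, coeff_C, coeff_C_mul, coeff_X]
  by_cases h0 : m = 0
  · subst h0; simp
  by_cases h : ∃ i, m = Finsupp.single i 1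
  · obtain ⟨i, rfl⟩ := h
    have h0' := Ne.symm h0
    fin_cases i <;> simp_all [Finsupp.single_left_inj]
  · push Not at h
    rw [if_neg (Ne.symm h0), if_neg (Ne.symm (h 0)), if_neg (Ne.symm (h 1)),
      if_neg (Ne.symm (h 2))]
    simp only [mul_zero, add_zero]
    refine coeff_eq_zero_of_totalDegree_lt (lt_of_le_of_lt hf ?_)
    by_contra hlt
    have hs : ∑ i, m i ≤ 1 := by
      rw [← Finset.sum_subset (Finset.subset_univ m.support) (by simp)]
      omega
    rw [Fin.sum_univ_three] at hs
    by_cases e0 : m 0 = 1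
    · exact h 0 (by ext i; fin_cases i <;> simp <;> omega)
    by_cases e1 : m 1 = 1
    · exact h 1 (by ext i; fin_cases i <;> simp <;> omega)
    by_cases e2 : m 2 = 1
    · exact h 2 (by ext i; fin_cases i <;> simp <;> omega)
    exact h0 (by ext i; fin_cases i <;> simp <;> omega)

/-! ### Degree descent by Vieta involutions -/

theorem totalDegree_frickeVogt_add_one : (frickeVogt + 1).totalDegree ≤ 3 := by
  have e : frickeVogt + 1 = X 0 ^ 2 + X 1 ^ 2 + X 2 ^ 2 - C (2 : ℤ) * X 0 * X 1 * X 2 := by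
    simp only [frickeVogt, map_ofNat]; ring
  rw [e]
  refine (totalDegree_sub _ _).trans (max_le ?_ ?_)
  · refine (totalDegree_add _ _).trans (max_le ((totalDegree_add _ _).trans (max_le ?_ ?_)) ?_) <;>
      simp [totalDegree_X_pow]
  · refine (totalDegree_mul _ _).trans ?_
    refine (add_le_add ((totalDegree_mul _ _).trans
      (add_le_add (totalDegree_mul _ _) le_rfl)) le_rfl).trans ?_
    simp only [totalDegree_C, totalDegree_X]
    norm_num

/-- No component of a solution of `I(f, g, h) = I(x, y, z)` with `(f, g, h)(1,1,1) = (1,1,1)`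
is constant. -/
theorem totalDegree_pos_of_solution {f g h : MvPolynomial (Fin 3) ℤ}
    (e : f ^ 2 + g ^ 2 + h ^ 2 - 2 * f * g * h - 1 = frickeVogt)
    (h1 : eval (fun _ => (1 : ℤ)) h = 1) : 0 < h.totalDegree := by
  by_contra hd
  obtain ⟨c, rfl⟩ : ∃ c, h = C c :=
    ⟨_, totalDegree_eq_zero_iff_eq_C.1 (by omega)⟩
  rw [eval_C] at h1
  subst h1
  -- With h = 1 the left side is (f - g)², while the invariant takes the value -1 at the origin.
  have := congrArg (eval (fun _ => (0 : ℤ))) e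
  simp only [frickeVogt, map_sub, map_add, map_mul, map_pow, map_one, map_ofNat, eval_X] at this
  nlinarith [sq_nonneg (eval (fun _ => (0 : ℤ)) f - eval (fun _ => (0 : ℤ)) g)]

/-- The two roots f and 2gh - f have product g² + h² - (I + 1) and sum 2gh. If the second root had
degree at least deg f ≥ 2, the product would force deg g or deg h to equal deg f. Then 2gh would
have degree above that of both roots, since the remaining component is not constant. -/
theorem totalDegree_vieta_lt {f g h : MvPolynomial (Fin 3) ℤ}
    (e : f ^ 2 + g ^ 2 + h ^ 2 - 2 * f * g * h - 1 = frickeVogt)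
    (hf : 0 < f.totalDegree) (hg : 0 < g.totalDegree) (hh : 0 < h.totalDegree)
    (hgf : g.totalDegree ≤ f.totalDegree) (hhf : h.totalDegree ≤ f.totalDegree)
    (hne : f.totalDegree ≠ 1) :
    (2 * g * h - f).totalDegree < f.totalDegree := by
  by_cases hz : 2 * g * h - f = 0
  · rw [hz]; simpa using hf
  have ne_zero : ∀ {p : MvPolynomial (Fin 3) ℤ}, 0 < p.totalDegree → p ≠ 0 := by
    rintro p hp rfl; simp at hp
  have hprod : f.totalDegree + (2 * g * h - f).totalDegree
      ≤ max 3 (max (2 * g.totalDegree) (2 * h.totalDegree)) := by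
    rw [← totalDegree_mul_of_isDomain (ne_zero hf) hz]
    have e' : f * (2 * g * h - f) = g ^ 2 + h ^ 2 - (frickeVogt + 1) := by
      linear_combination -e
    rw [e']
    refine (totalDegree_sub _ _).trans (max_le ((totalDegree_add _ _).trans (max_le ?_ ?_)) ?_)
    · exact (totalDegree_pow _ _).trans (by omega)
    · exact (totalDegree_pow _ _).trans (by omega)
    · exact totalDegree_frickeVogt_add_one.trans (by omega)
  have hsum : g.totalDegree + h.totalDegree
      ≤ max (2 * g * h - f).totalDegree f.totalDegree := by
    have h2 : (2 : MvPolynomial (Fin 3) ℤ) = C 2 := by simp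
    have : g.totalDegree + h.totalDegree = (2 * g * h).totalDegree := by
      rw [mul_assoc, totalDegree_mul_of_isDomain two_ne_zero
        (mul_ne_zero (ne_zero hg) (ne_zero hh)),
        totalDegree_mul_of_isDomain (ne_zero hg) (ne_zero hh), h2, totalDegree_C, zero_add]
    rw [this]
    conv_lhs => rw [← sub_add_cancel (2 * g * h) f]
    exact totalDegree_add _ _
  omega

namespace PolyMap

/-- The permutation of the coordinates by `σ`. -/
noncomputable def perm (σ : Equiv.Perm (Fin 3)) : PolyMap := ⟨fun i => X (σ i)⟩

/-- The Vieta involution in the coordinate `i`; for `i = 2` it is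
`(x, y, z) ↦ (x, y, 2xy - z)`. -/
noncomputable def vieta (i : Fin 3) : PolyMap :=
  ⟨fun k => if k = i then 2 * X (i + 1) * X (i + 2) - X i else X k⟩

theorem perm_mul_coord (σ : Equiv.Perm (Fin 3)) (F : PolyMap) (i : Fin 3) :
    (perm σ * F).coord i = F.coord (σ i) := by
  simp [mul_coord, perm]

theorem vieta_mul_coord (i : Fin 3) (F : PolyMap) (k : Fin 3) :
    (vieta i * F).coord k =
      if k = i then 2 * F.coord (i + 1) * F.coord (i + 2) - F.coord i else F.coord k := by
  rw [mul_coord, vieta]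
  dsimp only
  split_ifs <;> simp only [map_sub, map_mul, map_ofNat, bind₁_X_right]

theorem perm_mul_perm (σ τ : Equiv.Perm (Fin 3)) : perm σ * perm τ = perm (τ * σ) := by
  ext1; funext i; rw [perm_mul_coord]; rfl

theorem perm_one : perm 1 = 1 := rfl

theorem vieta_mul_self_mul (i : Fin 3) (F : PolyMap) : vieta i * (vieta i * F) = F := by
  ext1; funext k
  have h1 : i + 1 ≠ i := by fin_cases i <;> decide
  have h2 : i + 2 ≠ i := by fin_cases i <;> decide
  simp only [vieta_mul_coord, h1, h2, if_true, if_false]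
  split_ifs with h
  · rw [h]; ring
  · rfl

theorem bind₁_frickeVogt (F : PolyMap) (i : Fin 3) : bind₁ F.coord frickeVogt =
    F.coord i ^ 2 + F.coord (i + 1) ^ 2 + F.coord (i + 2) ^ 2
      - 2 * F.coord i * F.coord (i + 1) * F.coord (i + 2) - 1 := by
  simp only [frickeVogt, map_sub, map_add, map_mul, map_pow, bind₁_X_right, map_one, map_ofNat]
  fin_cases i <;> simp only [Fin.zero_eta, Fin.mk_one, Fin.reduceFinMk, Fin.reduceAdd, Fin.isValue,
    zero_add] <;> ring

theorem bind₁_frickeVogt_eq_sum (F : PolyMap) : bind₁ F.coord frickeVogt =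
    ∑ i, F.coord i ^ 2 - 2 * ∏ i, F.coord i - 1 := by
  rw [bind₁_frickeVogt F 0, Fin.sum_univ_three, Fin.prod_univ_three]
  simp only [zero_add, mul_assoc]

theorem perm_mul_mem {F : PolyMap} (hF : F ∈ nielsenMaps) (σ : Equiv.Perm (Fin 3)) :
    perm σ * F ∈ nielsenMaps := by
  refine ⟨?_, fun i => ?_⟩
  · refine Eq.trans ?_ hF.1
    rw [bind₁_frickeVogt_eq_sum, bind₁_frickeVogt_eq_sum]
    simp only [perm_mul_coord]
    rw [Equiv.sum_comp σ fun i => F.coord i ^ 2, Equiv.prod_comp σ F.coord]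
  · rw [perm_mul_coord]; exact hF.2 _

theorem vieta_mul_mem {F : PolyMap} (hF : F ∈ nielsenMaps) (i : Fin 3) :
    vieta i * F ∈ nielsenMaps := by
  have h1 : i + 1 ≠ i := by fin_cases i <;> decide
  have h2 : i + 2 ≠ i := by fin_cases i <;> decide
  refine ⟨?_, fun k => ?_⟩
  · refine Eq.trans ?_ hF.1
    rw [bind₁_frickeVogt _ i, bind₁_frickeVogt _ i]
    simp only [vieta_mul_coord, h1, h2, if_true, if_false]
    ring
  · rw [vieta_mul_coord]
    split_ifs
    · simp [hF.2]
    · exact hF.2 k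

theorem perm_mem (σ : Equiv.Perm (Fin 3)) : perm σ ∈ nielsenMaps :=
  mul_one (perm σ) ▸ perm_mul_mem nielsenMaps.one_mem σ

theorem vieta_mem (i : Fin 3) : vieta i ∈ nielsenMaps :=
  mul_one (vieta i) ▸ vieta_mul_mem nielsenMaps.one_mem i

theorem totalDegree_coord_pos {F : PolyMap} (hF : F ∈ nielsenMaps) (i : Fin 3) :
    0 < (F.coord i).totalDegree := by
  refine totalDegree_pos_of_solution (f := F.coord (i + 1)) (g := F.coord (i + 2)) ?_ (hF.2 i)
  rw [← hF.1, bind₁_frickeVogt F i]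
  ring

theorem eq_perm_of_totalDegree_le_one {F : PolyMap} (hF : F ∈ nielsenMaps)
    (hd : ∀ i, (F.coord i).totalDegree ≤ 1) : ∃ σ, F = perm σ := by
  obtain ⟨a₀, a₁, a₂, a₃, ha⟩ := eq_linear_of_totalDegree_le_one (hd 0)
  obtain ⟨b₀, b₁, b₂, b₃, hb⟩ := eq_linear_of_totalDegree_le_one (hd 1)
  obtain ⟨c₀, c₁, c₂, c₃, hc⟩ := eq_linear_of_totalDegree_le_one (hd 2)
  have h0 := hF.2 0
  have h1 := hF.2 1
  have h2 := hF.2 2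
  rw [ha] at h0; rw [hb] at h1; rw [hc] at h2
  simp only [map_add, map_mul, eval_C, eval_X, mul_one] at h0 h1 h2
  have key := linear_solution_eq_perm (fun x y z => ?_) h0 h1 h2
  · obtain ⟨⟨rfl, rfl, rfl⟩, H⟩ := key
    have mk : ∀ σ : Equiv.Perm (Fin 3), F.coord 0 = X (σ 0) → F.coord 1 = X (σ 1) →
        F.coord 2 = X (σ 2) → ∃ σ, F = perm σ := fun σ e0 e1 e2 =>
      ⟨σ, by ext1; funext i; fin_cases i <;> assumption⟩
    rcases H with H | H | H | H | H | H <;>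
      obtain ⟨rfl, rfl, rfl, rfl, rfl, rfl, rfl, rfl, rfl⟩ := H <;>
      simp only [map_zero, map_one, zero_mul, one_mul, zero_add, add_zero] at ha hb hc
    · exact mk 1 ha hb hc
    · exact mk (Equiv.swap 1 2) ha hb hc
    · exact mk (Equiv.swap 0 1) ha hb hc
    · exact mk (finRotate 3) ha hb hc
    · exact mk (finRotate 3)⁻¹ ha hb hc
    · exact mk (Equiv.swap 0 2) ha hb hc
  · have e := congrArg (eval ![x, y, z]) hF.1
    rw [bind₁_frickeVogt F 0] at e
    simp only [zero_add] at e
    rw [ha, hb, hc] at e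
    simpa [frickeVogt] using e

theorem totalDegree_vieta_coord_lt {F : PolyMap} (hF : F ∈ nielsenMaps)
    (hp : ∀ σ, F ≠ perm σ) {i : Fin 3}
    (hi : ∀ k, (F.coord k).totalDegree ≤ (F.coord i).totalDegree) :
    ((vieta i * F).coord i).totalDegree < (F.coord i).totalDegree := by
  rw [vieta_mul_coord, if_pos rfl]
  refine totalDegree_vieta_lt ?_ (totalDegree_coord_pos hF _) (totalDegree_coord_pos hF _)
    (totalDegree_coord_pos hF _) (hi _) (hi _) fun h => ?_
  · rw [← hF.1, bind₁_frickeVogt F i]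
  · obtain ⟨σ, hσ⟩ := eq_perm_of_totalDegree_le_one hF fun k => (hi k).trans h.le
    exact hp σ hσ

/-- The sum of the degrees of the components. -/
noncomputable def degreeSum (F : PolyMap) : ℕ := ∑ i, (F.coord i).totalDegree

theorem degreeSum_vieta_lt {F : PolyMap} (hF : F ∈ nielsenMaps)
    (hp : ∀ σ, F ≠ perm σ) {i : Fin 3}
    (hi : ∀ k, (F.coord k).totalDegree ≤ (F.coord i).totalDegree) :
    (vieta i * F).degreeSum < F.degreeSum := by
  refine Finset.sum_lt_sum (fun k _ => ?_)
    ⟨i, Finset.mem_univ i, totalDegree_vieta_coord_lt hF hp hi⟩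
  by_cases h : k = i
  · subst h; exact (totalDegree_vieta_coord_lt hF hp hi).le
  · rw [vieta_mul_coord, if_neg h]

/-- Induction over the defining set: every element arises from a permutation of the coordinates
by Vieta involutions, each in the (then unique) coordinate of largest degree. -/
theorem nielsenMaps_induction {P : PolyMap → Prop} (hperm : ∀ σ, P (perm σ))
    (hvieta : ∀ F ∈ nielsenMaps, ∀ i, P F →
      (∀ k, ((vieta i * F).coord k).totalDegree ≤ ((vieta i * F).coord i).totalDegree) →
      (∀ σ, vieta i * F ≠ perm σ) → P (vieta i * F))
    (F : PolyMap) (hF : F ∈ nielsenMaps) : P F := by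
  induction hn : F.degreeSum using Nat.strong_induction_on generalizing F with
  | _ n ih =>
    by_cases hp : ∃ σ, F = perm σ
    · obtain ⟨σ, rfl⟩ := hp; exact hperm σ
    · push Not at hp
      obtain ⟨i, -, hi⟩ := Finset.exists_max_image Finset.univ
        (fun i => (F.coord i).totalDegree) Finset.univ_nonempty
      have hi' : ∀ k, (F.coord k).totalDegree ≤ (F.coord i).totalDegree :=
        fun k => hi k (Finset.mem_univ k)
      have := hvieta (vieta i * F) (vieta_mul_mem hF i) i
        (ih _ (hn ▸ degreeSum_vieta_lt hF hp hi') _ (vieta_mul_mem hF i) rfl)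
      rw [vieta_mul_self_mul] at this
      exact this hi' hp

end PolyMap

/-! ### Ping-pong on real points -/

namespace PolyMap

/-- The action of a polynomial mapping on real points. -/
noncomputable def act (F : PolyMap) (p : Fin 3 → ℝ) : Fin 3 → ℝ := fun i => aeval p (F.coord i)

theorem act_one (p : Fin 3 → ℝ) : (1 : PolyMap).act p = p := by
  funext i; exact aeval_X p i

theorem act_mul (F G : PolyMap) (p : Fin 3 → ℝ) : (F * G).act p = F.act (G.act p) := by
  funext i
  simp only [act, mul_coord]
  rw [aeval_bind₁]
  rfl

theorem act_perm (σ : Equiv.Perm (Fin 3)) (p : Fin 3 → ℝ) : (perm σ).act p = fun i => p (σ i) := by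
  funext i; exact aeval_X p _

theorem act_vieta (i : Fin 3) (p : Fin 3 → ℝ) (k : Fin 3) :
    (vieta i).act p k = if k = i then 2 * p (i + 1) * p (i + 2) - p i else p k := by
  simp only [act, vieta]
  split_ifs <;> simp only [map_sub, map_mul, map_ofNat, aeval_X]

/-- The part of the region `1 < x, y, z` in which the `i`-th coordinate is larger than the product
of the two others. -/
def dominantRegion (i : Fin 3) : Set (Fin 3 → ℝ) := {p | (∀ k, 1 < p k) ∧ ∏ k, p k < p i ^ 2}

/-- Dominance of both x and y would give x > yz > xz² > x. -/
theorem dominantRegion_index_unique {i k : Fin 3} {p : Fin 3 → ℝ} (hi : p ∈ dominantRegion i)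
    (hk : p ∈ dominantRegion k) : i = k := by
  have aux : ∀ {x y z : ℝ}, 1 < x → 1 < y → 1 < z → x * y * z < x ^ 2 → x * y * z < y ^ 2 →
      False := by
    intro x y z hx hy hz h1 h2
    have h1' : y * z < x := by
      by_contra h; nlinarith
    have h2' : x * z < y := by
      by_contra h; nlinarith
    nlinarith
  have h0 := hi.1 0
  have h1 := hi.1 1
  have h2 := hi.1 2
  have hi2 := hi.2
  have hk2 := hk.2
  rw [Fin.prod_univ_three] at hi2 hk2
  by_contra hne
  fin_cases i <;> fin_cases k <;> (first | exact hne rfl | skip) <;>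
    simp only [Fin.zero_eta, Fin.mk_one, Fin.reduceFinMk] at hi2 hk2
  · exact aux h0 h1 h2 hi2 hk2
  · exact aux h0 h2 h1 (by linarith) (by linarith)
  · exact aux h1 h0 h2 (by linarith) (by linarith)
  · exact aux h1 h2 h0 (by linarith) (by linarith)
  · exact aux h2 h0 h1 (by linarith) (by linarith)
  · exact aux h2 h1 h0 (by linarith) (by linarith)

theorem act_perm_mem_dominantRegion (σ : Equiv.Perm (Fin 3)) {k : Fin 3} {p : Fin 3 → ℝ}
    (hp : p ∈ dominantRegion k) : (perm σ).act p ∈ dominantRegion (σ⁻¹ k) := by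
  rw [act_perm]
  refine ⟨fun i => hp.1 _, ?_⟩
  rw [Equiv.prod_comp σ p]
  simpa using hp.2

/-- If x > yz, then z < x < xy, so the new coordinate 2xy - z exceeds xy. -/
theorem act_vieta_mem_dominantRegion {i k : Fin 3} (hki : k ≠ i) {p : Fin 3 → ℝ}
    (hp : p ∈ dominantRegion k) : (vieta i).act p ∈ dominantRegion i := by
  have aux : ∀ {x y z : ℝ}, 1 < x → 1 < y → 1 < z → x * y * z < x ^ 2 →
      1 < 2 * x * y - z ∧ x * y * (2 * x * y - z) < (2 * x * y - z) ^ 2 := by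
    intro x y z hx hy hz h
    have h1 : y * z < x := by
      by_contra h; nlinarith
    have h2 : z < x * y := by nlinarith
    have h3 : 1 < 2 * x * y - z := by nlinarith
    exact ⟨h3, by nlinarith⟩
  have h0 := hp.1 0
  have h1 := hp.1 1
  have h2 := hp.1 2
  have hp2 := hp.2
  rw [Fin.prod_univ_three] at hp2
  simp only [dominantRegion, Set.mem_ofPred_eq, act_vieta, Fin.prod_univ_three]
  fin_cases i <;> fin_cases k <;> (first | exact absurd rfl hki | skip) <;>
    simp only [Fin.zero_eta, Fin.mk_one, Fin.reduceFinMk] at hp2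
  · have := aux h1 h2 h0 (by linarith)
    refine ⟨fun j => by fin_cases j <;> simp <;> linarith, ?_⟩
    simp; linarith
  · have := aux h2 h1 h0 (by linarith)
    refine ⟨fun j => by fin_cases j <;> simp <;> linarith, ?_⟩
    simp; linarith
  · have := aux h0 h2 h1 (by linarith)
    refine ⟨fun j => by fin_cases j <;> simp <;> linarith, ?_⟩
    simp; linarith
  · have := aux h2 h0 h1 (by linarith)
    refine ⟨fun j => by fin_cases j <;> simp <;> linarith, ?_⟩
    simp; linarith
  · have := aux h0 h1 h2 (by linarith)
    refine ⟨fun j => by fin_cases j <;> simp <;> linarith, ?_⟩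
    simp; linarith
  · have := aux h1 h0 h2 (by linarith)
    refine ⟨fun j => by fin_cases j <;> simp <;> linarith, ?_⟩
    simp; linarith

/-- An element that is not a permutation maps two of the three dominant regions into one. -/
theorem eq_perm_or_mapsTo_dominantRegion {F : PolyMap} (hF : F ∈ nielsenMaps) :
    (∃ σ, F = perm σ) ∨ ∃ i j, ∀ k ≠ j, ∀ p ∈ dominantRegion k, F.act p ∈ dominantRegion i := by
  -- The induction also records that the target region has the index of a component of largest
  -- degree; this prevents the next Vieta involution from using the same index.
  suffices H : (∃ σ, F = perm σ) ∨ ∃ i j,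
      (∀ k, (F.coord k).totalDegree ≤ (F.coord i).totalDegree) ∧
      ∀ k ≠ j, ∀ p ∈ dominantRegion k, F.act p ∈ dominantRegion i by
    rcases H with H | ⟨i, j, -, H⟩
    exacts [Or.inl H, Or.inr ⟨i, j, H⟩]
  refine nielsenMaps_induction (P := fun F => (∃ σ, F = perm σ) ∨ ∃ i j,
      (∀ k, (F.coord k).totalDegree ≤ (F.coord i).totalDegree) ∧
      ∀ k ≠ j, ∀ p ∈ dominantRegion k, F.act p ∈ dominantRegion i)
    (fun σ => Or.inl ⟨σ, rfl⟩) (fun F hF i ih hmax hnp => Or.inr ?_) F hF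
  by_cases hp : ∃ σ, F = perm σ
  · obtain ⟨σ, rfl⟩ := hp
    refine ⟨i, σ i, hmax, fun k hk p hp => ?_⟩
    rw [act_mul]
    refine act_vieta_mem_dominantRegion (fun h => hk ?_) (act_perm_mem_dominantRegion σ hp)
    rw [← h]; simp
  · obtain ⟨i', j, hmax', H⟩ := ih.resolve_left hp
    push Not at hp
    refine ⟨i, j, hmax, fun k hk p hp' => ?_⟩
    rw [act_mul]
    refine act_vieta_mem_dominantRegion ?_ (H k hk p hp')
    -- With equal indices, the same Vieta involution would strictly lower the degree of this
    -- component in both directions.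
    rintro rfl
    have h1 := totalDegree_vieta_coord_lt (vieta_mul_mem hF i') hnp hmax
    rw [vieta_mul_self_mul] at h1
    exact lt_asymm h1 (totalDegree_vieta_coord_lt hF hp hmax')

end PolyMap

/-- The matrix with the given entries, as an element of `GL(2, ℤ)`. -/
noncomputable def gl2 (a b c d : ℤ) (h : a * d - b * c = 1 ∨ a * d - b * c = -1) :
    GL (Fin 2) ℤ :=
  Matrix.GeneralLinearGroup.mk'' !![a, b; c, d]
    (by rw [Matrix.det_fin_two_of]; exact Int.isUnit_iff.2 h)

theorem coe_gl2 (a b c d : ℤ) (h : a * d - b * c = 1 ∨ a * d - b * c = -1) :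
    (gl2 a b c d h : Matrix (Fin 2) (Fin 2) ℤ) = !![a, b; c, d] := rfl

/-- The point `(cosh a, cosh b, cosh (a + b))` of the surface `I = 0`. -/
noncomputable def coshPoint (a b : ℝ) : Fin 3 → ℝ :=
  ![Real.cosh a, Real.cosh b, Real.cosh (a + b)]

theorem coshPoint_zero (a b : ℝ) : coshPoint a b 0 = Real.cosh a := rfl

theorem coshPoint_one (a b : ℝ) : coshPoint a b 1 = Real.cosh b := rfl

theorem coshPoint_two (a b : ℝ) : coshPoint a b 2 = Real.cosh (a + b) := rfl

/-! ### Matrices describing the action on the surface I = 0 -/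

namespace PolyMap

/-- `F` acts on the points `coshPoint a b` as the matrix `M` acts on the vectors `(a, b)`. -/
def ActsAs (F : PolyMap) (M : Matrix (Fin 2) (Fin 2) ℤ) : Prop :=
  ∀ a b : ℝ, F.act (coshPoint a b) =
    coshPoint (M 0 0 * a + M 0 1 * b) (M 1 0 * a + M 1 1 * b)

theorem ActsAs.mul {F G : PolyMap} {M N : Matrix (Fin 2) (Fin 2) ℤ} (hF : F.ActsAs M)
    (hG : G.ActsAs N) : (F * G).ActsAs (M * N) := by
  intro a b
  rw [act_mul, hG, hF]
  simp only [Matrix.mul_apply, Fin.sum_univ_two]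
  push_cast
  congr 1 <;> ring

theorem actsAs_one : (1 : PolyMap).ActsAs 1 := by
  intro a b; simp [act_one]

/-- Evenness of cosh is the source of the sign ambiguity. -/
theorem actsAs_one_neg_one : (1 : PolyMap).ActsAs (-1) := by
  intro a b
  have : Real.cosh (-a + -b) = Real.cosh (a + b) := by
    rw [← Real.cosh_neg (a + b)]; ring_nf
  simp only [act_one, coshPoint]
  norm_num [this]

/-- The identity cosh(u+v) + cosh(u-v) = 2 cosh u cosh v, at u = a+b and v = b, makes the involution
exchange cosh a and cosh(a+2b). The other two Vieta involutions work in the same way. -/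
theorem actsAs_vieta_zero : (vieta 0).ActsAs !![1, 2; 0, -1] := by
  intro a b
  have h0 : Real.cosh (a + 2 * b) = 2 * Real.cosh b * Real.cosh (a + b) - Real.cosh a := by
    have h1 : a + 2 * b = (a + b) + b := by ring
    have h2 : Real.cosh a = Real.cosh ((a + b) - b) := by ring_nf
    rw [h1, h2, Real.cosh_add, Real.cosh_sub]; ring
  have h1 : a + 2 * b + -b = a + b := by ring
  funext k
  rw [act_vieta]
  fin_cases k <;> simp [coshPoint, h0, h1]

theorem actsAs_vieta_one : (vieta 1).ActsAs !![-1, 0; 2, 1] := by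
  intro a b
  have h0 : Real.cosh (2 * a + b) = 2 * Real.cosh (a + b) * Real.cosh a - Real.cosh b := by
    have h1 : 2 * a + b = (a + b) + a := by ring
    have h2 : Real.cosh b = Real.cosh ((a + b) - a) := by ring_nf
    rw [h1, h2, Real.cosh_add, Real.cosh_sub]; ring
  have h1 : -a + (2 * a + b) = a + b := by ring
  funext k
  rw [act_vieta]
  fin_cases k <;> simp [coshPoint, h0, h1]

theorem actsAs_vieta_two : (vieta 2).ActsAs !![1, 0; 0, -1] := by
  intro a b
  have h0 : Real.cosh (a + -b) = 2 * Real.cosh a * Real.cosh b - Real.cosh (a + b) := by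
    rw [← sub_eq_add_neg, Real.cosh_add, Real.cosh_sub]; ring
  funext k
  rw [act_vieta]
  fin_cases k <;> simp [coshPoint, h0]

theorem actsAs_swap_zero_one : (perm (Equiv.swap 0 1)).ActsAs !![0, 1; 1, 0] := by
  intro a b
  rw [act_perm]
  funext k
  fin_cases k <;> simp [coshPoint, Equiv.swap_apply_def, add_comm]

theorem actsAs_swap_one_two : (perm (Equiv.swap 1 2)).ActsAs !![-1, 0; 1, 1] := by
  intro a b
  rw [act_perm]
  funext k
  fin_cases k <;> simp [coshPoint, Equiv.swap_apply_def]

theorem exists_actsAs {F : PolyMap} (hF : F ∈ nielsenMaps) :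
    ∃ M : GL (Fin 2) ℤ, F.ActsAs M := by
  refine nielsenMaps_induction (P := fun F => ∃ M : GL (Fin 2) ℤ, F.ActsAs M)
    (fun σ => ?_) (fun F _ i hF _ _ => ?_) F hF
  · have hσ : σ ∈ Submonoid.closure
        (Set.range fun i : Fin 2 => Equiv.swap i.castSucc i.succ) := by
      rw [Equiv.Perm.mclosure_swap_castSucc_succ]; trivial
    induction hσ using Submonoid.closure_induction with
    | mem σ h =>
      obtain ⟨i, rfl⟩ := h
      fin_cases i
      · exact ⟨gl2 0 1 1 0 (by norm_num), actsAs_swap_zero_one⟩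
      · exact ⟨gl2 (-1) 0 1 1 (by norm_num), actsAs_swap_one_two⟩
    | one => exact ⟨1, actsAs_one⟩
    | mul σ τ _ _ hσ hτ =>
      obtain ⟨M, hM⟩ := hσ
      obtain ⟨N, hN⟩ := hτ
      exact ⟨N * M, perm_mul_perm τ σ ▸ hN.mul hM⟩
  · obtain ⟨M, hM⟩ := hF
    have hv : ∃ N : GL (Fin 2) ℤ, (vieta i).ActsAs N := by
      fin_cases i
      · exact ⟨gl2 1 2 0 (-1) (by norm_num), actsAs_vieta_zero⟩
      · exact ⟨gl2 (-1) 0 2 1 (by norm_num), actsAs_vieta_one⟩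
      · exact ⟨gl2 1 0 0 (-1) (by norm_num), actsAs_vieta_two⟩
    obtain ⟨N, hN⟩ := hv
    exact ⟨N * M, hN.mul hM⟩

/-- Faithfulness of the action: a permutation is detected at one point with distinct coordinates.
Any other element would send fixed points from two disjoint regions into a single region. -/
theorem eq_one_of_actsAs_one {F : PolyMap} (hF : F ∈ nielsenMaps) (h : F.ActsAs 1) : F = 1 := by
  have h' : ∀ a b : ℝ, F.act (coshPoint a b) = coshPoint a b := by
    intro a b; simpa using h a b
  have hinj : ∀ {x y : ℝ}, 0 ≤ x → 0 ≤ y → Real.cosh x = Real.cosh y → x = y := by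
    intro x y hx hy e
    have h1 := Real.cosh_le_cosh.1 e.le
    have h2 := Real.cosh_le_cosh.1 e.ge
    rw [abs_of_nonneg hx, abs_of_nonneg hy] at h1 h2
    exact le_antisymm h1 h2
  rcases eq_perm_or_mapsTo_dominantRegion hF with ⟨σ, rfl⟩ | ⟨i, j, H⟩
  · have hσ : ∀ k : Fin 3, σ k = k := by
      -- This point has the distinct coordinates cosh 1, cosh 2, cosh 3.
      have h2 := h' 1 2
      rw [act_perm] at h2
      have hc : ∀ k : Fin 3, coshPoint 1 2 k = Real.cosh ((k : ℕ) + 1) := by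
        intro k; fin_cases k <;> simp [coshPoint] <;> norm_num
      intro k
      have := congrFun h2 k
      simp only [hc] at this
      have := hinj (by positivity) (by positivity) this
      have h3 : ((σ k : ℕ) : ℝ) = ((k : ℕ) : ℝ) := by linarith
      exact Fin.ext (by exact_mod_cast h3)
    rw [show σ = 1 from Equiv.ext hσ, perm_one]
  · exfalso
    have hc1 : 1 < Real.cosh 1 := Real.one_lt_cosh.2 one_ne_zero
    have hc2 : Real.cosh 2 = 2 * Real.cosh 1 ^ 2 - 1 := by
      have := Real.cosh_two_mul 1
      have h2 := Real.cosh_sq 1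
      rw [mul_one] at this
      linarith
    have hc3 : Real.cosh 1 * Real.cosh 1 * Real.cosh 2 < Real.cosh 2 ^ 2 := by
      have : Real.cosh 1 * Real.cosh 1 < Real.cosh 2 := by nlinarith
      have : 1 < Real.cosh 2 := by nlinarith
      nlinarith
    -- The witnesses have coordinates cosh 1, cosh 1, cosh 2 in some order, and cosh 2 = 2 cosh² 1 -
    -- 1 exceeds cosh² 1.
    have hne : ∀ k, ∃ a b : ℝ, coshPoint a b ∈ dominantRegion k := by
      have hc4 : 1 < Real.cosh 2 := Real.one_lt_cosh.2 two_ne_zero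
      intro k
      fin_cases k
      · refine ⟨2, -1, fun k => ?_, ?_⟩
        · fin_cases k <;> simp [coshPoint]
          norm_num
        · simp only [Fin.prod_univ_three, Fin.zero_eta, coshPoint_zero, coshPoint_one,
            coshPoint_two]
          norm_num; linarith
      · refine ⟨1, -2, fun k => ?_, ?_⟩
        · fin_cases k <;> simp [coshPoint]
          norm_num
        · simp only [Fin.prod_univ_three, Fin.mk_one, coshPoint_zero, coshPoint_one,
            coshPoint_two]
          norm_num; linarith
      · refine ⟨1, 1, fun k => ?_, ?_⟩
        · fin_cases k <;> simp [coshPoint]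
        · simp only [Fin.prod_univ_three, Fin.reduceFinMk, coshPoint_zero, coshPoint_one,
            coshPoint_two]
          norm_num; linarith
    have hk : ∀ k ≠ j, i = k := by
      intro k hk
      obtain ⟨a, b, hab⟩ := hne k
      have := H k hk _ hab
      rw [h'] at this
      exact dominantRegion_index_unique this hab
    have e1 := hk (j + 1) (by fin_cases j <;> decide)
    have e2 := hk (j + 2) (by fin_cases j <;> decide)
    rw [e1] at e2
    exact absurd e2 (by fin_cases j <;> decide)

/-- Testing at (1,0) and (0,1) leaves a diagonal matrix with entries ±1; the third coordinate at
(1,1) forces the two signs to agree. -/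
theorem eq_one_or_neg_one_of_one_actsAs {M : Matrix (Fin 2) (Fin 2) ℤ}
    (h : (1 : PolyMap).ActsAs M) : M = 1 ∨ M = -1 := by
  have habs : ∀ {x y : ℝ}, Real.cosh x = Real.cosh y → |x| = |y| := fun e =>
    le_antisymm (Real.cosh_le_cosh.1 e.le) (Real.cosh_le_cosh.1 e.ge)
  simp only [ActsAs, act_one] at h
  have h0 : ∀ a b : ℝ, |a| = |M 0 0 * a + M 0 1 * b| := fun a b => habs (congrFun (h a b) 0)
  have h1 : ∀ a b : ℝ, |b| = |M 1 0 * a + M 1 1 * b| := fun a b => habs (congrFun (h a b) 1)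
  have h2 : ∀ a b : ℝ, |a + b| = |M 0 0 * a + M 0 1 * b + (M 1 0 * a + M 1 1 * b)| :=
    fun a b => habs (congrFun (h a b) 2)
  have e00 : |M 0 0| = 1 := by have := h0 1 0; norm_num at this; exact_mod_cast this.symm
  have e01 : M 0 1 = 0 := by have := h0 0 1; norm_num at this; exact_mod_cast abs_eq_zero.1 this.symm
  have e10 : M 1 0 = 0 := by have := h1 1 0; norm_num at this; exact_mod_cast abs_eq_zero.1 this.symm
  have e11 : |M 1 1| = 1 := by have := h1 0 1; norm_num at this; exact_mod_cast this.symm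
  have e : |M 0 0 + M 1 1| = 2 := by
    have := h2 1 1
    rw [e01, e10] at this
    norm_num at this
    exact_mod_cast this.symm
  rw [M.eta_fin_two, e01, e10]
  rcases (abs_eq zero_le_one).1 e00 with a | a <;> rcases (abs_eq zero_le_one).1 e11 with b | b <;>
    rw [a, b] at e ⊢
  · left; exact Matrix.one_fin_two.symm
  · norm_num at e
  · norm_num at e
  · right; rw [Matrix.one_fin_two]; simp

end PolyMap

namespace PolyMap

theorem ActsAs.of_mul_eq_one {F G : PolyMap} {M N : Matrix (Fin 2) (Fin 2) ℤ} (hF : F.ActsAs M)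
    (hGF : G * F = 1) (hMN : M * N = 1) : G.ActsAs N := by
  intro a b
  have e : ∀ i j, ((M * N) i j : ℝ) = (1 : Matrix (Fin 2) (Fin 2) ℤ) i j := fun i j => by rw [hMN]
  have e00 := e 0 0
  have e01 := e 0 1
  have e10 := e 1 0
  have e11 := e 1 1
  simp only [Matrix.mul_apply, Fin.sum_univ_two, Matrix.one_apply_eq, ne_eq, zero_ne_one,
    one_ne_zero, not_false_eq_true, Matrix.one_apply_ne] at e00 e01 e10 e11
  push_cast at e00 e01 e10 e11
  have h := hF (N 0 0 * a + N 0 1 * b) (N 1 0 * a + N 1 1 * b)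
  have e₁ : (M 0 0 * (N 0 0 * a + N 0 1 * b) + M 0 1 * (N 1 0 * a + N 1 1 * b) : ℝ) = a := by
    linear_combination a * e00 + b * e01
  have e₂ : (M 1 0 * (N 0 0 * a + N 0 1 * b) + M 1 1 * (N 1 0 * a + N 1 1 * b) : ℝ) = b := by
    linear_combination a * e10 + b * e11
  rw [e₁, e₂] at h
  rw [← h, ← act_mul, hGF, act_one]

end PolyMap

/-! ### The group as `GL(2, ℤ)` modulo sign -/

namespace NielsenGroup
open PolyMap

/-- The permutation of the coordinates by `σ` as an element of the group. -/
noncomputable def perm (σ : Equiv.Perm (Fin 3)) : NielsenGroup where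
  val := ⟨PolyMap.perm σ, perm_mem σ⟩
  inv := ⟨PolyMap.perm σ⁻¹, perm_mem σ⁻¹⟩
  val_inv := Subtype.ext (by simp [perm_mul_perm, perm_one])
  inv_val := Subtype.ext (by simp [perm_mul_perm, perm_one])

/-- The Vieta involution in the coordinate `i` as an element of the group. -/
noncomputable def vieta (i : Fin 3) : NielsenGroup where
  val := ⟨PolyMap.vieta i, vieta_mem i⟩
  inv := ⟨PolyMap.vieta i, vieta_mem i⟩
  val_inv := Subtype.ext (by simpa using vieta_mul_self_mul i 1)
  inv_val := Subtype.ext (by simpa using vieta_mul_self_mul i 1)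

theorem exists_coe_eq {F : PolyMap} (hF : F ∈ nielsenMaps) :
    ∃ u : NielsenGroup, (u : nielsenMaps).1 = F := by
  refine nielsenMaps_induction (P := fun F => ∃ u : NielsenGroup, (u : nielsenMaps).1 = F)
    (fun σ => ⟨perm σ, rfl⟩) (fun F _ i hF _ _ => ?_) F hF
  obtain ⟨u, rfl⟩ := hF
  exact ⟨vieta i * u, rfl⟩

theorem isUnit (F : nielsenMaps) : IsUnit F := by
  obtain ⟨u, hu⟩ := exists_coe_eq F.2
  exact ⟨u, Subtype.ext hu⟩

/-- `u` acts on the points `coshPoint a b` as `M` acts on the vectors `(a, b)`. -/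
def ActsAs (u : NielsenGroup) (M : GL (Fin 2) ℤ) : Prop := (u : nielsenMaps).1.ActsAs M

theorem ActsAs.mul {u v : NielsenGroup} {M N : GL (Fin 2) ℤ} (hu : ActsAs u M) (hv : ActsAs v N) :
    ActsAs (u * v) (M * N) :=
  PolyMap.ActsAs.mul hu hv

theorem ActsAs.inv {u : NielsenGroup} {M : GL (Fin 2) ℤ} (hu : ActsAs u M) : ActsAs u⁻¹ M⁻¹ :=
  PolyMap.ActsAs.of_mul_eq_one hu (congrArg Subtype.val u.inv_mul) M.mul_inv

theorem ActsAs.eq_one {u : NielsenGroup} (hu : ActsAs u 1) : u = 1 :=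
  Units.ext (Subtype.ext (eq_one_of_actsAs_one (u : nielsenMaps).2 hu))

theorem ActsAs.unique {u v : NielsenGroup} {M : GL (Fin 2) ℤ} (hu : ActsAs u M)
    (hv : ActsAs v M) : u = v := by
  rw [← mul_inv_eq_one]
  refine ActsAs.eq_one ?_
  rw [← mul_inv_cancel M]
  exact hu.mul hv.inv

/-- The matrices that are realised by an element of the group. -/
def realised : Subgroup (GL (Fin 2) ℤ) where
  carrier := {M | ∃ u : NielsenGroup, ActsAs u M}
  one_mem' := ⟨1, actsAs_one⟩
  mul_mem' := by
    rintro M N ⟨u, hu⟩ ⟨v, hv⟩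
    exact ⟨u * v, hu.mul hv⟩
  inv_mem' := by
    rintro M ⟨u, hu⟩
    exact ⟨u⁻¹, hu.inv⟩

theorem actsAs_vieta_two : ActsAs (vieta 2) (gl2 1 0 0 (-1) (by norm_num)) :=
  PolyMap.actsAs_vieta_two

/-- The generators S and T of `SL(2, ℤ)` are products of realised matrices, and one realised matrix
of determinant -1 supplies the other coset. -/
theorem realised_eq_top : realised = ⊤ := by
  have hv2 : gl2 1 0 0 (-1) (by norm_num) ∈ realised := ⟨vieta 2, actsAs_vieta_two⟩
  have h01 : gl2 0 1 1 0 (by norm_num) ∈ realised := ⟨perm _, actsAs_swap_zero_one⟩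
  have h12 : gl2 (-1) 0 1 1 (by norm_num) ∈ realised := ⟨perm _, actsAs_swap_one_two⟩
  have hS : (ModularGroup.S : GL (Fin 2) ℤ) ∈ realised := by
    have : (ModularGroup.S : GL (Fin 2) ℤ) =
        gl2 0 1 1 0 (by norm_num) * gl2 1 0 0 (-1) (by norm_num) := by
      refine Units.ext ?_
      change !![0, -1; 1, 0] = !![0, 1; 1, 0] * !![1, 0; 0, -1]
      simp
    rw [this]; exact realised.mul_mem h01 hv2
  have hT : (ModularGroup.T : GL (Fin 2) ℤ) ∈ realised := by
    have : (ModularGroup.T : GL (Fin 2) ℤ) = gl2 1 0 0 (-1) (by norm_num) *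
        gl2 0 1 1 0 (by norm_num) * gl2 (-1) 0 1 1 (by norm_num) * gl2 0 1 1 0 (by norm_num) := by
      refine Units.ext ?_
      change !![1, 1; 0, 1] = !![1, 0; 0, -1] * !![0, 1; 1, 0] * !![-1, 0; 1, 1] * !![0, 1; 1, 0]
      simp
    rw [this]
    exact realised.mul_mem (realised.mul_mem (realised.mul_mem hv2 h01) h12) h01
  have hSL : ∀ A : Matrix.SpecialLinearGroup (Fin 2) ℤ, (A : GL (Fin 2) ℤ) ∈ realised := by
    intro A
    have : Matrix.SpecialLinearGroup.toGL.range ≤ realised := by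
      rw [MonoidHom.range_eq_map, ← SpecialLinearGroup.SL2Z_generators,
        MonoidHom.map_closure, Subgroup.closure_le]
      rintro _ ⟨B, rfl | rfl, rfl⟩
      exacts [hS, hT]
    exact this ⟨A, rfl⟩
  have hdet : ∀ M : GL (Fin 2) ℤ, M.1.det = 1 → M ∈ realised := by
    intro M h
    have : M = Matrix.SpecialLinearGroup.toGL ⟨M.1, h⟩ := Units.ext rfl
    rw [this]; exact hSL _
  rw [eq_top_iff]
  rintro M -
  rcases Int.isUnit_iff.1 ((Matrix.isUnit_iff_isUnit_det _).1 M.isUnit) with h | h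
  · exact hdet M h
  · refine (realised.mul_mem_cancel_right hv2).1 (hdet _ ?_)
    rw [Units.val_mul, Matrix.det_mul, h, coe_gl2, Matrix.det_fin_two_of]; norm_num

/-- The homomorphism from `GL(2, ℤ)` onto the group. -/
noncomputable def ofGL : GL (Fin 2) ℤ →* NielsenGroup :=
  have h : ∀ M : GL (Fin 2) ℤ, ∃ u : NielsenGroup, ActsAs u M := fun M =>
    (realised_eq_top ▸ Subgroup.mem_top M : M ∈ realised)
  MonoidHom.mk' (fun M => (h M).choose) fun M N =>
    (h (M * N)).choose_spec.unique ((h M).choose_spec.mul (h N).choose_spec)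

theorem actsAs_ofGL (M : GL (Fin 2) ℤ) : ActsAs (ofGL M) M :=
  Exists.choose_spec (realised_eq_top ▸ Subgroup.mem_top M : M ∈ realised)

theorem ofGL_surjective : Function.Surjective ofGL := by
  intro u
  obtain ⟨M, hM⟩ := exists_actsAs (u : nielsenMaps).2
  exact ⟨M, (actsAs_ofGL M).unique hM⟩

theorem ofGL_eq_one_iff {M : GL (Fin 2) ℤ} : ofGL M = 1 ↔ M = 1 ∨ M = -1 := by
  constructor
  · intro h
    have h1 : ActsAs 1 M := h ▸ actsAs_ofGL M
    exact (eq_one_or_neg_one_of_one_actsAs h1).imp (fun e => Units.ext e) fun e => Units.ext e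
  · rintro (rfl | rfl)
    · exact map_one _
    · exact (actsAs_ofGL (-1)).unique actsAs_one_neg_one

end NielsenGroup

/-! ### Recognising dihedral reversing symmetry groups -/

section Dihedral

/-- A group generated by `r` and an involution `s ∉ ⟨r⟩` inverting `r` is dihedral. -/
theorem nonempty_mulEquiv_dihedralGroup {Γ : Type*} [Group Γ] (K : Subgroup Γ) {r s : Γ}
    (hs : s * s = 1) (hsr : s * r * s⁻¹ = r⁻¹) (hn : s ∉ Subgroup.zpowers r)
    (hK : ∀ g, g ∈ K ↔ g ∈ Subgroup.zpowers r ∨ g * s ∈ Subgroup.zpowers r) :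
    Nonempty (K ≃* DihedralGroup (orderOf r)) := by
  have hsi : s⁻¹ = s := inv_eq_of_mul_eq_one_left hs
  -- Infinite order is included: `orderOf r` is then 0, and `ZMod 0` is ℤ.
  let ρ : ZMod (orderOf r) →+ Additive Γ :=
    ZMod.lift _ ⟨zmultiplesHom (Additive Γ) (Additive.ofMul r), by
      simp [← ofMul_pow, pow_orderOf_eq_one]⟩
  have hρ : ∀ k : ℤ, (ρ (k : ZMod (orderOf r))).toMul = r ^ k := fun k => by
    simp [ρ, ← ofMul_zpow]
  have hρadd : ∀ i j, (ρ (i + j)).toMul = (ρ i).toMul * (ρ j).toMul := fun i j => by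
    rw [map_add]; rfl
  have hρs : ∀ i, (ρ i).toMul * s = s * (ρ (-i)).toMul := fun i => by
    obtain ⟨k, rfl⟩ := ZMod.intCast_surjective i
    have h1 : s * r ^ k * s⁻¹ = (r ^ k)⁻¹ := by
      rw [← conj_zpow, hsr, inv_zpow]
    rw [← Int.cast_neg, hρ, hρ, zpow_neg, ← h1, hsi]
    simp only [← mul_assoc, hs, one_mul]
  have hρinj : Function.Injective ρ := by
    rw [ZMod.lift_injective]
    intro k hk
    rw [ZMod.intCast_zmod_eq_zero_iff_dvd] at *
    rw [orderOf_dvd_iff_zpow_eq_one]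
    simpa [← ofMul_zpow] using hk
  have hρmem : ∀ i, (ρ i).toMul ∈ Subgroup.zpowers r := fun i => by
    obtain ⟨k, rfl⟩ := ZMod.intCast_surjective i
    rw [hρ]; exact ⟨k, rfl⟩
  have hρsurj : ∀ g ∈ Subgroup.zpowers r, ∃ i, (ρ i).toMul = g := by
    rintro _ ⟨k, rfl⟩; exact ⟨k, hρ k⟩
  let f : DihedralGroup (orderOf r) → Γ := fun x => match x with
    | .r i => (ρ i).toMul
    | .sr i => s * (ρ i).toMul
  have hf : ∀ x y, f (x * y) = f x * f y := by
    rintro (i | i) (j | j)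
    · exact hρadd i j
    · change s * (ρ (j - i)).toMul = (ρ i).toMul * (s * (ρ j).toMul)
      rw [← mul_assoc, hρs, mul_assoc, ← hρadd, neg_add_eq_sub]
    · change s * (ρ (i + j)).toMul = s * (ρ i).toMul * (ρ j).toMul
      rw [hρadd, mul_assoc]
    · change (ρ (j - i)).toMul = s * (ρ i).toMul * (s * (ρ j).toMul)
      rw [mul_assoc, ← mul_assoc _ s, hρs, ← mul_assoc, ← mul_assoc, hs, one_mul, ← hρadd,
        neg_add_eq_sub]
  have hns : ∀ i, s * (ρ i).toMul ∉ Subgroup.zpowers r := fun i h =>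
    hn ((Subgroup.mul_mem_cancel_right _ (hρmem i)).1 h)
  let φ : DihedralGroup (orderOf r) →* Γ := MonoidHom.mk' f hf
  have hφ : Function.Injective φ := by
    rw [injective_iff_map_eq_one]
    rintro (i | i) h
    · have : ρ i = ρ 0 := by rw [map_zero]; exact h
      rw [hρinj this]; rfl
    · have h' : s * (ρ i).toMul = 1 := h
      exact absurd (h' ▸ Subgroup.one_mem _) (hns i)
  have hrange : φ.range = K := by
    ext g
    rw [hK]
    constructor
    · rintro ⟨i | i, rfl⟩
      · exact Or.inl (hρmem i)
      · right
        change s * (ρ i).toMul * s ∈ _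
        rw [mul_assoc, hρs, ← mul_assoc, hs, one_mul]
        exact hρmem _
    · rintro (h | h)
      · obtain ⟨i, hi⟩ := hρsurj g h
        exact ⟨.r i, hi⟩
      · obtain ⟨i, hi⟩ := hρsurj _ h
        refine ⟨.sr (-i), ?_⟩
        change s * (ρ (-i)).toMul = g
        rw [← hρs, hi, mul_assoc, hs, mul_one]
  exact ⟨((MonoidHom.ofInjective hφ).trans (MulEquiv.subgroupCongr hrange)).symm⟩

/-- There is an involution `s ∉ ⟨F⟩` that inverts `F` and generates the reversing symmetry group
together with `F`. -/
def HasDihedralReverser {Γ : Type*} [Group Γ] (F : Γ) : Prop :=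
  ∃ s : Γ, s * s = 1 ∧ s * F * s⁻¹ = F⁻¹ ∧ s ∉ Subgroup.zpowers F ∧
    ∀ g ∈ reversingSymmetryGroup F, g ∈ Subgroup.zpowers F ∨ g * s ∈ Subgroup.zpowers F

variable {Γ : Type*} [Group Γ] {F s : Γ}

theorem mem_reversingSymmetryGroup {g : Γ} :
    g ∈ reversingSymmetryGroup F ↔ g * F * g⁻¹ = F ∨ g * F * g⁻¹ = F⁻¹ := Iff.rfl

theorem zpowers_le_reversingSymmetryGroup : Subgroup.zpowers F ≤ reversingSymmetryGroup F := by
  rw [Subgroup.zpowers_le]; exact Or.inl (by group)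

theorem HasDihedralReverser.nonempty_mulEquiv (h : HasDihedralReverser F) :
    Nonempty (reversingSymmetryGroup F ≃* DihedralGroup (orderOf F)) := by
  obtain ⟨s, hs, hsF, hn, hall⟩ := h
  refine nonempty_mulEquiv_dihedralGroup _ hs hsF hn fun g => ⟨hall g, ?_⟩
  rintro (hg | hg)
  · exact zpowers_le_reversingSymmetryGroup hg
  · exact (Subgroup.mul_mem_cancel_right _ (Or.inr hsF)).1
      (zpowers_le_reversingSymmetryGroup hg)

theorem HasDihedralReverser.isReversible (h : HasDihedralReverser F) : IsReversible F :=
  ⟨h.choose, h.choose_spec.2.1⟩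

theorem HasDihedralReverser.of_conj {g : Γ} (h : HasDihedralReverser (g * F * g⁻¹)) :
    HasDihedralReverser F := by
  have hz : ∀ x : Γ, g * x * g⁻¹ ∈ Subgroup.zpowers (g * F * g⁻¹) → x ∈ Subgroup.zpowers F := by
    rintro x ⟨k, hk⟩
    refine ⟨k, ?_⟩
    simpa [conj_zpow] using hk
  have hz' : ∀ x ∈ Subgroup.zpowers F, g * x * g⁻¹ ∈ Subgroup.zpowers (g * F * g⁻¹) := by
    rintro x ⟨k, rfl⟩
    exact ⟨k, by simp [conj_zpow]⟩
  obtain ⟨s, hs, hsF, hn, hall⟩ := h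
  have e1 : g * (g⁻¹ * s * g) * g⁻¹ = s := by group
  refine ⟨g⁻¹ * s * g, ?_, ?_, fun h => hn (by simpa [e1] using hz' _ h), fun x hx => ?_⟩
  · rw [show g⁻¹ * s * g * (g⁻¹ * s * g) = g⁻¹ * (s * s) * g by group, hs]; group
  · rw [show g⁻¹ * s * g * F * (g⁻¹ * s * g)⁻¹ = g⁻¹ * (s * (g * F * g⁻¹) * s⁻¹) * g by group,
      hsF]
    group
  · refine (hall (g * x * g⁻¹) ?_).imp (hz x) fun h => hz _ ?_
    · have e : g * x * g⁻¹ * (g * F * g⁻¹) * (g * x * g⁻¹)⁻¹ = g * (x * F * x⁻¹) * g⁻¹ := by group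
      rw [mem_reversingSymmetryGroup, e]
      refine (mem_reversingSymmetryGroup.1 hx).imp (fun h => by rw [h]) fun h => by rw [h]; group
    · rw [show g * (x * (g⁻¹ * s * g)) * g⁻¹ = g * x * g⁻¹ * s by group]
      exact h

/-- For an involution it suffices to know the centralizer. -/
theorem HasDihedralReverser.of_sq_eq_one (hF : F * F = 1) (hs : s * s = 1) (hs1 : s ≠ 1)
    (hsF : s ≠ F) (hc : s * F = F * s)
    (hall : ∀ g, g * F = F * g → g = 1 ∨ g = F ∨ g = s ∨ g = F * s) :
    HasDihedralReverser F := by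
  have hFi : F⁻¹ = F := inv_eq_of_mul_eq_one_left hF
  refine ⟨s, hs, by rw [hFi, hc, mul_inv_cancel_right], ?_, fun g hg => ?_⟩
  · have hF2 : F ^ 2 = 1 := by rw [pow_two, hF]
    rintro ⟨k, rfl⟩
    rcases Int.even_or_odd' k with ⟨m, rfl | rfl⟩
    · exact hs1 (by simp [zpow_mul, hF2])
    · exact hsF (by simp [zpow_add, zpow_mul, hF2])
  · have hg' : g * F = F * g := by
      rcases mem_reversingSymmetryGroup.1 hg with h | h
      · exact mul_inv_eq_iff_eq_mul.1 h
      · rw [hFi] at h; exact mul_inv_eq_iff_eq_mul.1 h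
    rcases hall g hg' with rfl | rfl | rfl | rfl
    · exact Or.inl (Subgroup.one_mem _)
    · exact Or.inl (Subgroup.mem_zpowers _)
    · exact Or.inr (hs ▸ Subgroup.one_mem _)
    · right; rw [mul_assoc, hs, mul_one]; exact Subgroup.mem_zpowers _

/-- For `F² ≠ 1` it suffices that the centralizer is generated by `F`. -/
theorem HasDihedralReverser.of_centralizer (hF : F * F ≠ 1) (hs : s * s = 1)
    (hsF : s * F * s⁻¹ = F⁻¹) (hall : ∀ g, g * F = F * g → g ∈ Subgroup.zpowers F) :
    HasDihedralReverser F := by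
  refine ⟨s, hs, hsF, ?_, fun g hg => ?_⟩
  · rintro ⟨k, rfl⟩
    have e : F ^ k * F * (F ^ k)⁻¹ = F := by group
    exact hF (mul_eq_one_iff_eq_inv.2 (e.symm.trans hsF))
  · rcases mem_reversingSymmetryGroup.1 hg with h | h
    · exact Or.inl (hall g (mul_inv_eq_iff_eq_mul.1 h))
    -- A product of two reversers is a symmetry.
    · refine Or.inr (hall _ (mul_inv_eq_iff_eq_mul.1 ?_))
      rw [show g * s * F * (g * s)⁻¹ = g * (s * F * s⁻¹) * g⁻¹ by group, hsF,
        show g * F⁻¹ * g⁻¹ = (g * F * g⁻¹)⁻¹ by group, h, inv_inv]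

end Dihedral

theorem gl2_mul_det {a b c d a' b' c' d' : ℤ} (h : a * d - b * c = 1 ∨ a * d - b * c = -1)
    (h' : a' * d' - b' * c' = 1 ∨ a' * d' - b' * c' = -1) :
    (a * a' + b * c') * (c * b' + d * d') - (a * b' + b * d') * (c * a' + d * c') = 1 ∨
    (a * a' + b * c') * (c * b' + d * d') - (a * b' + b * d') * (c * a' + d * c') = -1 := by
  have e : (a * a' + b * c') * (c * b' + d * d') - (a * b' + b * d') * (c * a' + d * c')
      = (a * d - b * c) * (a' * d' - b' * c') := by ring
  rw [e]
  rcases h with h | h <;> rcases h' with h' | h' <;> simp [h, h']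

/-! ### Centralizers of the models of finite order -/

namespace NielsenGroup

/-- The element of the group that belongs to the matrix with the given entries. -/
noncomputable def el (a b c d : ℤ) (h : a * d - b * c = 1 ∨ a * d - b * c = -1) : NielsenGroup :=
  ofGL (gl2 a b c d h)

variable {a b c d a' b' c' d' : ℤ} {h : a * d - b * c = 1 ∨ a * d - b * c = -1}
  {h' : a' * d' - b' * c' = 1 ∨ a' * d' - b' * c' = -1}

theorem exists_eq_gl2 (M : GL (Fin 2) ℤ) : ∃ a b c d h, M = gl2 a b c d h := by
  refine ⟨M.1 0 0, M.1 0 1, M.1 1 0, M.1 1 1, ?_, Units.ext (M.1.eta_fin_two)⟩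
  rw [← Matrix.det_fin_two]
  exact Int.isUnit_iff.1 ((Matrix.isUnit_iff_isUnit_det _).1 M.isUnit)

theorem exists_eq_el (g : NielsenGroup) : ∃ a b c d h, g = el a b c d h := by
  obtain ⟨M, rfl⟩ := ofGL_surjective g
  obtain ⟨a, b, c, d, h, rfl⟩ := exists_eq_gl2 M
  exact ⟨a, b, c, d, h, rfl⟩

theorem ofGL_eq_iff {M N : GL (Fin 2) ℤ} : ofGL M = ofGL N ↔ M = N ∨ M = -N := by
  rw [← mul_inv_eq_one, ← map_inv, ← map_mul, ofGL_eq_one_iff, mul_inv_eq_one,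
    mul_inv_eq_iff_eq_mul, neg_one_mul]

theorem el_eq_iff : el a b c d h = el a' b' c' d' h' ↔
    (a = a' ∧ b = b' ∧ c = c' ∧ d = d') ∨ (a = -a' ∧ b = -b' ∧ c = -c' ∧ d = -d') := by
  rw [el, el, ofGL_eq_iff, Units.ext_iff, Units.ext_iff, Units.val_neg, coe_gl2, coe_gl2,
    ← Matrix.ext_iff, ← Matrix.ext_iff]
  simp [Fin.forall_fin_two, and_assoc]

theorem el_mul : el a b c d h * el a' b' c' d' h' = el (a * a' + b * c') (a * b' + b * d')
    (c * a' + d * c') (c * b' + d * d') (gl2_mul_det h h') := by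
  rw [el, el, ← map_mul, el]
  congr 1
  refine Units.ext ?_
  rw [Units.val_mul, coe_gl2, coe_gl2, coe_gl2, Matrix.mul_fin_two]

theorem el_one : el 1 0 0 1 (by norm_num) = 1 := by
  rw [el, show gl2 1 0 0 1 (by norm_num) = 1 from Units.ext Matrix.one_fin_two.symm, map_one]

theorem el_eq_one_iff : el a b c d h = 1 ↔
    (a = 1 ∧ b = 0 ∧ c = 0 ∧ d = 1) ∨ (a = -1 ∧ b = 0 ∧ c = 0 ∧ d = -1) := by
  rw [← el_one, el_eq_iff]; simp

theorem int_mul_eq_one_or {x y : ℤ} (h : x * y = 1 ∨ x * y = -1) :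
    (x = 1 ∨ x = -1) ∧ (y = 1 ∨ y = -1) := by
  have h' := Int.isUnit_iff.2 h
  exact ⟨Int.isUnit_iff.1 (isUnit_of_mul_isUnit_left h'),
    Int.isUnit_iff.1 (isUnit_of_mul_isUnit_right h')⟩

/-- Commuting modulo sign means commuting or anticommuting. In both cases the determinant is, up to
sign, a sum of two squares, so only four elements remain. -/
theorem hasDihedralReverser_rotation_two :
    HasDihedralReverser (el 0 (-1) 1 0 (by norm_num)) := by
  refine HasDihedralReverser.of_sq_eq_one (s := el 1 0 0 (-1) (by norm_num)) ?_ ?_ ?_ ?_ ?_ ?_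
  · rw [el_mul, el_eq_one_iff]; norm_num
  · rw [el_mul, el_eq_one_iff]; norm_num
  · rw [ne_eq, el_eq_one_iff]; norm_num
  · rw [ne_eq, el_eq_iff]; norm_num
  · rw [el_mul, el_mul, el_eq_iff]; norm_num
  · intro g hg
    obtain ⟨p, q, r, u, h, rfl⟩ := exists_eq_el g
    rw [el_mul, el_mul, el_eq_iff] at hg
    rw [el_eq_one_iff, el_mul, el_eq_iff, el_eq_iff, el_eq_iff]
    have key : ∀ {x y : ℤ}, x * x + y * y = 1 ∨ x * x + y * y = -1 →
        (x = 0 ∧ (y = 1 ∨ y = -1)) ∨ (y = 0 ∧ (x = 1 ∨ x = -1)) := by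
      intro x y h
      have hx1 : x ≤ 1 := by rcases h with h | h <;> nlinarith
      have hx2 : -1 ≤ x := by rcases h with h | h <;> nlinarith
      have hy1 : y ≤ 1 := by rcases h with h | h <;> nlinarith
      have hy2 : -1 ≤ y := by rcases h with h | h <;> nlinarith
      interval_cases x <;> interval_cases y <;> simp_all
    rcases hg with hg | hg
    · obtain ⟨rfl, rfl⟩ : p = u ∧ q = -r := by omega
      have := key (x := p) (y := r) (by rcases h with h | h <;> [left; right] <;> linarith)
      clear h hg
      rcases this with ⟨rfl, rfl | rfl⟩ | ⟨rfl, rfl | rfl⟩ <;> simp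
    · obtain ⟨rfl, rfl⟩ : p = -u ∧ q = r := by omega
      have := key (x := u) (y := q) (by rcases h with h | h <;> [right; left] <;> linarith)
      clear h hg
      rcases this with ⟨rfl, rfl | rfl⟩ | ⟨rfl, rfl | rfl⟩ <;> simp

theorem hasDihedralReverser_diagonal :
    HasDihedralReverser (el 1 0 0 (-1) (by norm_num)) := by
  refine HasDihedralReverser.of_sq_eq_one (s := el 0 1 1 0 (by norm_num)) ?_ ?_ ?_ ?_ ?_ ?_
  · rw [el_mul, el_eq_one_iff]; norm_num
  · rw [el_mul, el_eq_one_iff]; norm_num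
  · rw [ne_eq, el_eq_one_iff]; norm_num
  · rw [ne_eq, el_eq_iff]; norm_num
  · rw [el_mul, el_mul, el_eq_iff]; norm_num
  · intro g hg
    obtain ⟨p, q, r, u, h, rfl⟩ := exists_eq_el g
    rw [el_mul, el_mul, el_eq_iff] at hg
    rw [el_eq_one_iff, el_mul, el_eq_iff, el_eq_iff, el_eq_iff]
    rcases hg with hg | hg
    · obtain ⟨rfl, rfl⟩ : q = 0 ∧ r = 0 := by omega
      have := int_mul_eq_one_or (x := p) (y := u) (by simpa using h)
      clear h hg
      rcases this with ⟨rfl | rfl, rfl | rfl⟩ <;> simp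
    · obtain ⟨rfl, rfl⟩ : p = 0 ∧ u = 0 := by omega
      have := int_mul_eq_one_or (x := q) (y := r) 
        (by rcases h with h | h <;> [right; left] <;> linarith)
      clear h hg
      rcases this with ⟨rfl | rfl, rfl | rfl⟩ <;> simp

/-- Here the determinant is, up to sign, a difference of two squares, whose two linear factors must
be units. -/
theorem hasDihedralReverser_swap :
    HasDihedralReverser (el 0 1 1 0 (by norm_num)) := by
  refine HasDihedralReverser.of_sq_eq_one (s := el 1 0 0 (-1) (by norm_num)) ?_ ?_ ?_ ?_ ?_ ?_
  · rw [el_mul, el_eq_one_iff]; norm_num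
  · rw [el_mul, el_eq_one_iff]; norm_num
  · rw [ne_eq, el_eq_one_iff]; norm_num
  · rw [ne_eq, el_eq_iff]; norm_num
  · rw [el_mul, el_mul, el_eq_iff]; norm_num
  · intro g hg
    obtain ⟨p, q, r, u, h, rfl⟩ := exists_eq_el g
    rw [el_mul, el_mul, el_eq_iff] at hg
    rw [el_eq_one_iff, el_mul, el_eq_iff, el_eq_iff, el_eq_iff]
    rcases hg with hg | hg
    · obtain ⟨rfl, rfl⟩ : p = u ∧ q = r := by omega
      have := int_mul_eq_one_or (x := p + q) (y := p - q)
        (by rcases h with h | h <;> [left; right] <;> linarith)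
      have : (p = 0 ∧ (q = 1 ∨ q = -1)) ∨ (q = 0 ∧ (p = 1 ∨ p = -1)) := by clear h hg; omega
      clear h hg
      rcases this with ⟨rfl, rfl | rfl⟩ | ⟨rfl, rfl | rfl⟩ <;> simp
    · obtain ⟨rfl, rfl⟩ : p = -u ∧ q = -r := by omega
      have := int_mul_eq_one_or (x := u + r) (y := u - r)
        (by rcases h with h | h <;> [right; left] <;> linarith)
      have : (u = 0 ∧ (r = 1 ∨ r = -1)) ∨ (r = 0 ∧ (u = 1 ∨ u = -1)) := by clear h hg; omega
      clear h hg
      rcases this with ⟨rfl, rfl | rfl⟩ | ⟨rfl, rfl | rfl⟩ <;> simp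

/-- The determinant on the commutant is the Eisenstein norm form p² - pq + q². Its six units are, up
to sign, the three powers of the rotation; anticommuting would force the zero matrix. -/
theorem hasDihedralReverser_rotation_three :
    HasDihedralReverser (el 0 (-1) 1 1 (by norm_num)) := by
  refine HasDihedralReverser.of_centralizer (s := el 0 1 1 0 (by norm_num)) ?_ ?_ ?_ ?_
  · rw [el_mul, ne_eq, el_eq_one_iff]; norm_num
  · rw [el_mul, el_eq_one_iff]; norm_num
  · rw [mul_inv_eq_iff_eq_mul, eq_inv_mul_iff_mul_eq, el_mul, el_mul, el_eq_iff]; norm_num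
  · intro g hg
    obtain ⟨p, q, r, u, h, rfl⟩ := exists_eq_el g
    rw [el_mul, el_mul, el_eq_iff] at hg
    have key : ∀ {x y : ℤ}, x * x - x * y + y * y = 1 ∨ x * x - x * y + y * y = -1 →
        (x = 0 ∧ (y = 1 ∨ y = -1)) ∨ (y = 0 ∧ (x = 1 ∨ x = -1)) ∨
          (x = y ∧ (x = 1 ∨ x = -1)) := by
      intro x y h
      have hx1 : x ≤ 1 := by rcases h with h | h <;> nlinarith [sq_nonneg (x - 2 * y)]
      have hx2 : -1 ≤ x := by rcases h with h | h <;> nlinarith [sq_nonneg (x - 2 * y)]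
      have hy1 : y ≤ 1 := by rcases h with h | h <;> nlinarith [sq_nonneg (y - 2 * x)]
      have hy2 : -1 ≤ y := by rcases h with h | h <;> nlinarith [sq_nonneg (y - 2 * x)]
      interval_cases x <;> interval_cases y <;> simp_all
    obtain ⟨rfl, rfl⟩ : r = -q ∧ u = p - q := by omega
    have := key (x := p) (y := q) (by rcases h with h | h <;> [left; right] <;> linarith)
    have e : el p q (-q) (p - q) h = 1 ∨ el p q (-q) (p - q) h = el 0 (-1) 1 1 (by norm_num) ∨
        el p q (-q) (p - q) h = el 0 (-1) 1 1 (by norm_num) * el 0 (-1) 1 1 (by norm_num) := by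
      rw [el_eq_one_iff, el_mul, el_eq_iff, el_eq_iff]
      clear h hg
      rcases this with ⟨rfl, rfl | rfl⟩ | ⟨rfl, rfl | rfl⟩ | ⟨rfl, rfl | rfl⟩ <;> simp
    rcases e with e | e | e <;> rw [e]
    · exact Subgroup.one_mem _
    · exact Subgroup.mem_zpowers _
    · exact Subgroup.mul_mem _ (Subgroup.mem_zpowers _) (Subgroup.mem_zpowers _)

end NielsenGroup

/-- `F` has infinite order and its centralizer is cyclic. -/
def HasCyclicCentralizer {Γ : Type*} [Group Γ] (F : Γ) : Prop :=
  ¬ IsOfFinOrder F ∧ ∃ c : Γ, ∀ g, g * F = F * g ↔ g ∈ Subgroup.zpowers c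

theorem HasCyclicCentralizer.of_conj {Γ : Type*} [Group Γ] {F x : Γ}
    (h : HasCyclicCentralizer (x * F * x⁻¹)) : HasCyclicCentralizer F := by
  obtain ⟨hF, c, hc⟩ := h
  refine ⟨fun h => hF ?_, x⁻¹ * c * x, fun g => ?_⟩
  · rw [isOfFinOrder_iff_pow_eq_one] at h ⊢
    obtain ⟨n, hn, h⟩ := h
    exact ⟨n, hn, by rw [conj_pow, h]; group⟩
  · have h1 : g * F = F * g ↔ x * g * x⁻¹ * (x * F * x⁻¹) = x * F * x⁻¹ * (x * g * x⁻¹) := by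
      rw [show x * g * x⁻¹ * (x * F * x⁻¹) = x * (g * F) * x⁻¹ by group,
        show x * F * x⁻¹ * (x * g * x⁻¹) = x * (F * g) * x⁻¹ by group]
      simp
    rw [h1, hc]
    constructor
    · rintro ⟨k, hk⟩
      refine ⟨k, ?_⟩
      have hk : c ^ k = x * g * x⁻¹ := hk
      change (x⁻¹ * c * x) ^ k = g
      have := conj_zpow (i := k) (a := x⁻¹) (b := c)
      rw [inv_inv] at this
      rw [this, hk]; group
    · rintro ⟨k, rfl⟩
      refine ⟨k, ?_⟩
      change c ^ k = x * (x⁻¹ * c * x) ^ k * x⁻¹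
      rw [← conj_zpow]; group

/-- `F ≠ 1`, `Fⁿ = 1`, and an involution outside `⟨F⟩` inverts `F` and generates the reversing
symmetry group together with `F`. -/
def IsDihedralRotation {Γ : Type*} [Group Γ] (n : ℕ) (F : Γ) : Prop :=
  F ^ n = 1 ∧ F ≠ 1 ∧ HasDihedralReverser F

theorem IsDihedralRotation.of_conj {Γ : Type*} [Group Γ] {n : ℕ} {F x : Γ}
    (h : IsDihedralRotation n (x * F * x⁻¹)) : IsDihedralRotation n F := by
  obtain ⟨h1, h2, h3⟩ := h
  rw [conj_pow, conj_eq_one_iff] at h1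
  rw [ne_eq, conj_eq_one_iff] at h2
  exact ⟨h1, h2, h3.of_conj⟩

/-- Division by 2|c| with remainder centred at 0. -/
theorem Int.exists_abs_add_mul_le (x : ℤ) {c : ℤ} (hc : c ≠ 0) : ∃ k, |x + 2 * k * c| ≤ |c| := by
  have hc' : 0 < |c| := abs_pos.2 hc
  have h1 := Int.emod_add_mul_ediv (x + |c|) (2 * |c|)
  have h2 := Int.emod_nonneg (x + |c|) (b := 2 * |c|) (by omega)
  have h3 := Int.emod_lt_of_pos (x + |c|) (b := 2 * |c|) (by omega)
  set q := (x + |c|) / (2 * |c|)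
  rcases abs_choice c with hc'' | hc''
  · refine ⟨-q, ?_⟩
    rw [abs_le]
    rw [hc''] at h1 h2 h3 ⊢
    constructor <;> linarith
  · refine ⟨q, ?_⟩
    rw [abs_le]
    rw [hc''] at h1 h2 h3 ⊢
    constructor <;> linarith

/-! ### Conjugacy reduction and the traces 0, 1, 2 -/

namespace NielsenGroup

variable {a b c d : ℤ} {h : a * d - b * c = 1 ∨ a * d - b * c = -1}

theorem el_neg : el a b c d h = el (-a) (-b) (-c) (-d) (by simpa using h) := by
  rw [el_eq_iff]; simp

theorem shift_conj_det (k : ℤ) (h : a * d - b * c = 1 ∨ a * d - b * c = -1) :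
    (a + k * c) * (d - k * c) - (b + k * (d - a) - k ^ 2 * c) * c = 1 ∨
    (a + k * c) * (d - k * c) - (b + k * (d - a) - k ^ 2 * c) * c = -1 := by
  rwa [show (a + k * c) * (d - k * c) - (b + k * (d - a) - k ^ 2 * c) * c = a * d - b * c by ring]

theorem shift_conj (k : ℤ) : el 1 k 0 1 (by simp) * el a b c d h * (el 1 k 0 1 (by simp))⁻¹ =
    el (a + k * c) (b + k * (d - a) - k ^ 2 * c) c (d - k * c) (shift_conj_det k h) := by
  rw [mul_inv_eq_iff_eq_mul, el_mul, el_mul, el_eq_iff]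
  left; refine ⟨?_, ?_, ?_, ?_⟩ <;> ring

theorem swap_conj : el 0 1 1 0 (by simp) * el a b c d h * (el 0 1 1 0 (by simp))⁻¹ =
    el d c b a (by rwa [mul_comm d, mul_comm c]) := by
  rw [mul_inv_eq_iff_eq_mul, el_mul, el_mul, el_eq_iff]
  left; refine ⟨?_, ?_, ?_, ?_⟩ <;> ring

theorem flip_conj : el 1 0 0 (-1) (by simp) * el a b c d h * (el 1 0 0 (-1) (by simp))⁻¹ =
    el a (-b) (-c) d (by simpa using h) := by
  rw [mul_inv_eq_iff_eq_mul, el_mul, el_mul, el_eq_iff]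
  left; refine ⟨?_, ?_, ?_, ?_⟩ <;> ring

/-- Reduction of integer matrices under conjugation. -/
theorem exists_reduced_conj (a b c d : ℤ) (h : a * d - b * c = 1 ∨ a * d - b * c = -1) :
    ∃ x a' b' c' d' h', x * el a b c d h * x⁻¹ = el a' b' c' d' h' ∧ a' + d' = a + d ∧
      a' * d' - b' * c' = a * d - b * c ∧ (c' = 0 ∨ |a' - d'| ≤ |c'| ∧ |c'| ≤ |b'|) := by
  induction hn : c.natAbs using Nat.strong_induction_on generalizing a b c d with
  | _ n ih =>
    by_cases hc : c = 0
    · exact ⟨1, a, b, c, d, h, by group, rfl, rfl, Or.inl hc⟩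
    -- As in Gauss reduction of binary forms, a shift makes |a - d| at most |c|. If the upper right
    -- entry is then smaller than c in absolute value, a swap moves it to the lower left and the
    -- descent continues.
    obtain ⟨k, hk⟩ := Int.exists_abs_add_mul_le (a - d) hc
    by_cases hb : |c| ≤ |b + k * (d - a) - k ^ 2 * c|
    · refine ⟨_, _, _, _, _, _, shift_conj k, by ring, by ring, Or.inr ⟨?_, hb⟩⟩
      convert hk using 2; ring
    · obtain ⟨x, a', b', c', d', h', e, e₁, e₂, e₃⟩ := ih
        (b + k * (d - a) - k ^ 2 * c).natAbs (by rw [← hn]; zify; exact not_le.1 hb) (d - k * c) c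
        (b + k * (d - a) - k ^ 2 * c) (a + k * c)
        (by rw [mul_comm (d - k * c), mul_comm c]; exact shift_conj_det k h) rfl
      refine ⟨x * (el 0 1 1 0 (by simp) * el 1 k 0 1 (by simp)), a', b', c', d', h', ?_,
        by rw [e₁]; ring, by rw [e₂]; ring, e₃⟩
      rw [← e, ← swap_conj (h := shift_conj_det k h), ← shift_conj (h := h)]
      group

theorem el_unipotent_zpow (n : ℤ) : el 1 1 0 1 (by simp) ^ n = el 1 n 0 1 (by simp) := by
  let f : Multiplicative ℤ →* NielsenGroup :=
    MonoidHom.mk' (fun n => el 1 n.toAdd 0 1 (by simp)) fun m n => by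
      rw [el_mul, el_eq_iff]; left; simp [add_comm]
  have := map_zpow f (Multiplicative.ofAdd 1) n
  rw [← ofAdd_zsmul] at this
  simpa [f] using this.symm

/-- Commuting forces a triangular matrix with equal diagonal entries ±1, which is up to sign a power
of the elementary unipotent matrix. -/
theorem hasCyclicCentralizer_unipotent {k : ℤ} (hk : k ≠ 0) :
    HasCyclicCentralizer (el 1 k 0 1 (by simp)) := by
  refine ⟨fun hF => ?_, el 1 1 0 1 (by simp), fun g => ⟨fun hg => ?_, ?_⟩⟩
  · obtain ⟨n, hn, e⟩ := isOfFinOrder_iff_pow_eq_one.1 hF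
    rw [← el_unipotent_zpow, ← zpow_natCast, ← zpow_mul, el_unipotent_zpow, el_eq_one_iff] at e
    simp [hk, hn.ne'] at e
  · obtain ⟨p, q, r, u, hu, rfl⟩ := exists_eq_el g
    rw [el_mul, el_mul, el_eq_iff] at hg
    have hr : r = 0 := by
      rcases hg with ⟨-, -, -, e⟩ | ⟨-, -, e, -⟩
      · have : r * k = 0 := by linarith
        exact (mul_eq_zero.1 this).resolve_right hk
      · linarith
    subst hr
    simp only [mul_zero, sub_zero] at hu
    obtain ⟨hp, hu'⟩ := int_mul_eq_one_or hu
    have hpu : p = u := by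
      rcases hg with ⟨-, e, -, -⟩ | ⟨e, -, -, -⟩
      · have : k * (p - u) = 0 := by linarith
        have := (mul_eq_zero.1 this).resolve_left hk
        linarith
      · omega
    subst hpu
    rcases hp with rfl | rfl
    · exact ⟨q, el_unipotent_zpow q⟩
    · refine ⟨-q, (el_unipotent_zpow (-q)).trans ?_⟩
      rw [el_eq_iff]; simp
  · rintro ⟨n, rfl⟩
    change el 1 1 0 1 _ ^ n * _ = _ * el 1 1 0 1 _ ^ n
    rw [← el_unipotent_zpow k, ← zpow_add, ← zpow_add, add_comm]

/-- After reduction 4a² ≤ c² ≤ |bc| = a² + 1, hence a = 0 and bc = -1. -/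
theorem isDihedralRotation_two_of_trace_zero_of_det_one (ht : a + d = 0)
    (hδ : a * d - b * c = 1) : IsDihedralRotation 2 (el a b c d h) := by
  obtain ⟨x, a, b, c, d, h, e, e₁, e₂, e₃⟩ := exists_reduced_conj a b c d h
  rw [ht] at e₁; rw [hδ] at e₂
  refine IsDihedralRotation.of_conj (x := x) ?_
  rw [e]
  obtain rfl : d = -a := by linarith
  have hc : c ≠ 0 := by rintro rfl; nlinarith [sq_nonneg a, sq_nonneg (2 * a - 1)]
  obtain ⟨hac, hcb⟩ := e₃.resolve_left hc
  have hsq : c ^ 2 ≤ |b * c| := by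
    rw [abs_mul, ← sq_abs]; nlinarith [abs_nonneg c]
  rw [show b * c = -(a ^ 2 + 1) by linarith, abs_neg, abs_of_nonneg (by positivity)] at hsq
  have hac' : (a - -a) ^ 2 ≤ c ^ 2 := sq_le_sq.2 hac
  have ha : a = 0 := by nlinarith
  subst ha
  have e : el 0 b c (-0) h = el 0 (-1) 1 0 (by norm_num) := by
    rw [el_eq_iff]
    have := int_mul_eq_one_or (x := b) (y := c) (by right; linarith)
    rcases this with ⟨rfl | rfl, rfl | rfl⟩ <;> simp_all
  rw [e]
  refine ⟨?_, ?_, hasDihedralReverser_rotation_two⟩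
  · rw [pow_two, el_mul, el_eq_one_iff]; norm_num
  · rw [ne_eq, el_eq_one_iff]; norm_num

theorem isDihedralRotation_swap : IsDihedralRotation 2 (el 0 1 1 0 (by norm_num)) := by
  refine ⟨?_, ?_, hasDihedralReverser_swap⟩
  · rw [pow_two, el_mul, el_eq_one_iff]; norm_num
  · rw [ne_eq, el_eq_one_iff]; norm_num

/-- The parity of b decides between the two models of determinant -1: even b is conjugate to the
diagonal one, odd b to the swap. -/
theorem isDihedralRotation_triangular (b : ℤ) :
    IsDihedralRotation 2 (el 1 b 0 (-1) (by norm_num)) := by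
  rcases Int.even_or_odd' b with ⟨k, rfl | rfl⟩
  · refine IsDihedralRotation.of_conj (x := el 1 k 0 1 (by simp)) ?_
    rw [shift_conj, show el (1 + k * 0) (2 * k + k * (-1 - 1) - k ^ 2 * 0) 0 (-1 - k * 0) _ =
      el 1 0 0 (-1) (by norm_num) by rw [el_eq_iff]; left; norm_num; ring]
    refine ⟨?_, ?_, hasDihedralReverser_diagonal⟩
    · rw [pow_two, el_mul, el_eq_one_iff]; norm_num
    · rw [ne_eq, el_eq_one_iff]; norm_num
  · refine IsDihedralRotation.of_conj (x := el 1 0 1 1 (by simp) * el 1 k 0 1 (by simp)) ?_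
    rw [show el 1 0 1 1 (by simp) * el 1 k 0 1 (by simp) * el 1 (2 * k + 1) 0 (-1) (by norm_num) *
        (el 1 0 1 1 (by simp) * el 1 k 0 1 (by simp))⁻¹ = el 0 1 1 0 (by norm_num) by
      rw [mul_inv_eq_iff_eq_mul, el_mul, el_mul, el_mul, el_eq_iff]
      left; refine ⟨?_, ?_, ?_, ?_⟩ <;> ring]
    exact isDihedralRotation_swap

/-- For c ≠ 0, reduction gives 4a² ≤ c² ≤ |a² - 1|, hence a = 0 and the swap; c = 0 is the
triangular case. -/
theorem isDihedralRotation_two_of_trace_zero_of_det_neg_one (ht : a + d = 0)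
    (hδ : a * d - b * c = -1) : IsDihedralRotation 2 (el a b c d h) := by
  obtain ⟨x, a, b, c, d, h, e, e₁, e₂, e₃⟩ := exists_reduced_conj a b c d h
  rw [ht] at e₁; rw [hδ] at e₂
  refine IsDihedralRotation.of_conj (x := x) ?_
  rw [e]
  obtain rfl : d = -a := by linarith
  by_cases hc : c = 0
  · subst hc
    have := int_mul_eq_one_or (x := a) (y := a) (by left; linarith)
    rcases this.1 with rfl | rfl
    · exact isDihedralRotation_triangular b
    · rw [el_neg]
      exact isDihedralRotation_triangular (-b)
  · obtain ⟨hac, hcb⟩ := e₃.resolve_left hc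
    have hsq : c ^ 2 ≤ |b * c| := by
      rw [abs_mul, ← sq_abs]; nlinarith [abs_nonneg c]
    rw [show b * c = -(a ^ 2 - 1) by linarith, abs_neg] at hsq
    have hac' : (a - -a) ^ 2 ≤ c ^ 2 := sq_le_sq.2 hac
    have ha : a = 0 := by
      by_contra ha
      have : 1 ≤ a ^ 2 := by nlinarith [Int.one_le_abs ha, sq_abs a]
      rw [abs_of_nonneg (by linarith)] at hsq
      nlinarith
    subst ha
    have e : el 0 b c (-0) h = el 0 1 1 0 (by norm_num) := by
      rw [el_eq_iff]
      have := int_mul_eq_one_or (x := b) (y := c) (by left; linarith)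
      rcases this with ⟨rfl | rfl, rfl | rfl⟩ <;> simp_all
    rw [e]
    exact isDihedralRotation_swap

/-- Reduction gives (2a - 1)² ≤ c² ≤ a² - a + 1, so a is 0 or 1 and bc = -1. Sign flips and swaps
carry the remaining matrices to the model, whose cube is -1. -/
theorem isDihedralRotation_three_of_trace_one (ht : a + d = 1) (hδ : a * d - b * c = 1) :
    IsDihedralRotation 3 (el a b c d h) := by
  obtain ⟨x, a, b, c, d, h, e, e₁, e₂, e₃⟩ := exists_reduced_conj a b c d h
  rw [ht] at e₁; rw [hδ] at e₂
  refine IsDihedralRotation.of_conj (x := x) ?_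
  rw [e]
  obtain rfl : d = 1 - a := by linarith
  have hc : c ≠ 0 := by rintro rfl; nlinarith [sq_nonneg a, sq_nonneg (2 * a - 1)]
  obtain ⟨hac, hcb⟩ := e₃.resolve_left hc
  have hsq : c ^ 2 ≤ |b * c| := by
    rw [abs_mul, ← sq_abs]; nlinarith [abs_nonneg c]
  rw [show b * c = -(a ^ 2 - a + 1) by linarith, abs_neg, abs_of_nonneg (by nlinarith)] at hsq
  have hac' : (a - (1 - a)) ^ 2 ≤ c ^ 2 := sq_le_sq.2 hac
  have hW : ∀ {a b c d : ℤ} {h}, (a = 0 ∧ b = -1 ∧ c = 1 ∧ d = 1) →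
      IsDihedralRotation 3 (el a b c d h) := by
    rintro _ _ _ _ _ ⟨rfl, rfl, rfl, rfl⟩
    refine ⟨?_, ?_, hasDihedralReverser_rotation_three⟩
    · rw [pow_succ, pow_two, el_mul, el_mul, el_eq_one_iff]; norm_num
    · rw [ne_eq, el_eq_one_iff]; norm_num
  have hW' : ∀ {a b c d : ℤ} {h}, (a = 0 ∧ b = 1 ∧ c = -1 ∧ d = 1) →
      IsDihedralRotation 3 (el a b c d h) := by
    rintro _ _ _ _ _ ⟨rfl, rfl, rfl, rfl⟩
    refine IsDihedralRotation.of_conj (x := el 1 0 0 (-1) (by simp)) ?_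
    rw [flip_conj]
    exact hW (by norm_num)
  have ha : a = 0 ∨ a = 1 := by
    have h1 : a ≤ 1 := by nlinarith
    have h2 : 0 ≤ a := by nlinarith
    omega
  rcases ha with rfl | rfl
  · have := int_mul_eq_one_or (x := b) (y := c) (by right; linarith)
    rcases this with ⟨rfl | rfl, rfl | rfl⟩ <;> 
      first | (refine hW ?_; norm_num; done) | (refine hW' ?_; norm_num; done) | simp at e₂
  · have := int_mul_eq_one_or (x := b) (y := c) (by right; linarith)
    refine IsDihedralRotation.of_conj (x := el 0 1 1 0 (by simp)) ?_
    rw [swap_conj]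
    rcases this with ⟨rfl | rfl, rfl | rfl⟩ <;> 
      first | (refine hW ?_; norm_num; done) | (refine hW' ?_; norm_num; done) | simp at e₂

/-- With c ≠ 0, reduction would give 4(a - 1)² ≤ c² ≤ (a - 1)², so a reduced matrix is unipotent
triangular. -/
theorem eq_one_or_hasCyclicCentralizer_of_trace_two (ht : a + d = 2) (hδ : a * d - b * c = 1) :
    el a b c d h = 1 ∨ HasCyclicCentralizer (el a b c d h) := by
  obtain ⟨x, a, b, c, d, h, e, e₁, e₂, e₃⟩ := exists_reduced_conj a b c d h
  rw [ht] at e₁; rw [hδ] at e₂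
  obtain rfl : d = 2 - a := by linarith
  have hc : c = 0 := by
    by_contra hc
    obtain ⟨hac, hcb⟩ := e₃.resolve_left hc
    have hsq : c ^ 2 ≤ |b * c| := by
      rw [abs_mul, ← sq_abs]; nlinarith [abs_nonneg c]
    rw [show b * c = -(a - 1) ^ 2 by linarith, abs_neg, abs_of_nonneg (by positivity)] at hsq
    have hac' : (a - (2 - a)) ^ 2 ≤ c ^ 2 := sq_le_sq.2 hac
    have : 0 < c ^ 2 := by positivity
    nlinarith
  subst hc
  have ha : a = 1 := by
    have : (a - 1) ^ 2 = 0 := by linarith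
    have := pow_eq_zero_iff (two_ne_zero) |>.1 this
    linarith
  subst ha
  by_cases hb : b = 0
  · subst hb
    left
    rw [← conj_eq_one_iff (a := x), e, el_eq_one_iff]
    norm_num
  · right
    refine HasCyclicCentralizer.of_conj (x := x) ?_
    rw [e]
    exact hasCyclicCentralizer_unipotent hb

end NielsenGroup

/-! ### Elements of nonsquare discriminant -/

/-- The number lies strictly between (|t| - 1)² and t². It is the discriminant for trace t and
determinant 1; t² + 4 is the one for determinant -1. -/
theorem not_isSquare_sq_sub_four {t : ℤ} (ht : 3 ≤ |t|) : ¬ IsSquare (t ^ 2 - 4) := by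
  rintro ⟨k, hk⟩
  rw [← sq_abs t, ← abs_mul_abs_self k] at hk
  have h0 := abs_nonneg k
  rcases le_or_gt |t| |k| with h | h <;> nlinarith

theorem not_isSquare_sq_add_four {t : ℤ} (ht : t ≠ 0) : ¬ IsSquare (t ^ 2 + 4) := by
  rintro ⟨k, hk⟩
  rw [← sq_abs t, ← abs_mul_abs_self k] at hk
  have h0 := abs_nonneg k
  have ht := Int.one_le_abs ht
  rcases le_or_gt |k| |t| with h | h
  · nlinarith
  · have h1 : |t| = 1 := by nlinarith
    rw [h1] at hk
    have : |k| < 3 := by nlinarith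
    have : 2 < |k| := by nlinarith
    omega

/-- A root of modulus greater than `1` of `X² - T X ± 1` with `T` an integer has modulus at least
`3/2`. -/
theorem three_halves_le_of_root {T δ : ℤ} {x : ℝ} (hδ : δ = 1 ∨ δ = -1)
    (hx : x ^ 2 - T * x + δ = 0) (h1 : 1 < |x|) : 3 / 2 ≤ |x| := by
  wlog h0 : 0 ≤ x generalizing x T
  · have := this (x := -x) (T := -T) (by push_cast; linarith) (by rwa [abs_neg]) (by linarith)
    rwa [abs_neg] at this
  rw [abs_of_nonneg h0] at h1 ⊢
  -- The smallest root in question is the golden ratio, from T = 1 and δ = -1; 3/2 is a rational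
  -- bound below it.
  by_contra! hlt
  rcases hδ with rfl | rfl <;> push_cast at hx
  · rcases le_or_gt T 2 with hT | hT
    · have : (T : ℝ) ≤ 2 := by exact_mod_cast hT
      nlinarith
    · have : (3 : ℝ) ≤ T := by exact_mod_cast hT
      nlinarith
  · rcases le_or_gt T 0 with hT | hT
    · have : (T : ℝ) ≤ 0 := by exact_mod_cast hT
      nlinarith
    · have : (1 : ℝ) ≤ T := by exact_mod_cast hT
      nlinarith

/-- The entries of a matrix that commutes with `[[a, b], [c, d]]`. -/
theorem entries_of_commute_gl2 {a b c d : ℤ} {h : a * d - b * c = 1 ∨ a * d - b * c = -1}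
    {N : GL (Fin 2) ℤ} (hN : N * gl2 a b c d h = gl2 a b c d h * N) :
    N.1 0 1 * c = b * N.1 1 0 ∧ b * (N.1 1 1 - N.1 0 0) = N.1 0 1 * (d - a) := by
  have e : N.1 * !![a, b; c, d] = !![a, b; c, d] * N.1 := congrArg Units.val hN
  have e0 := congrFun (congrFun e 0) 0
  have e1 := congrFun (congrFun e 0) 1
  simp [-Matrix.cons_mul, Matrix.mul_apply, Fin.sum_univ_two] at e0 e1
  constructor <;> linarith

/-- The eigenvalue, on the eigenvector `(1, κ)` of `[[a, b], [c, d]]`, of a matrix commuting with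
the latter. -/
noncomputable def commutantEigenvalue {a b c d : ℤ} {h : a * d - b * c = 1 ∨ a * d - b * c = -1}
    (hb : b ≠ 0) {κ : ℝ} (hκ : b * κ ^ 2 + (a - d) * κ - c = 0) :
    Subgroup.centralizer {gl2 a b c d h} →* ℝ where
  toFun N := N.1.1 0 0 + N.1.1 0 1 * κ
  map_one' := by simp
  map_mul' := by
    rintro ⟨N, hN⟩ ⟨N', hN'⟩
    obtain ⟨e₁, e₂⟩ := entries_of_commute_gl2
      (Subgroup.mem_centralizer_singleton_iff.1 hN')
    have hb' : (b : ℝ) ≠ 0 := by exact_mod_cast hb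
    have e₁' : (N'.1 0 1 * c : ℝ) = b * N'.1 1 0 := by exact_mod_cast e₁
    have e₂' : (b * (N'.1 1 1 - N'.1 0 0) : ℝ) = N'.1 0 1 * (d - a) := by exact_mod_cast e₂
    simp only [MulMemClass.mk_mul_mk, Units.val_mul, Matrix.mul_apply,
      Fin.sum_univ_two]
    push_cast
    refine mul_left_cancel₀ hb' ?_
    linear_combination (-N.1 0 1 * N'.1 0 1 : ℝ) * hκ - N.1 0 1 * e₁' + N.1 0 1 * κ * e₂'

namespace NielsenGroup

variable {a b c d : ℤ} {h : a * d - b * c = 1 ∨ a * d - b * c = -1}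

/-- Elements of nonzero trace commute in the group only if their matrices commute. -/
theorem commute_of_ofGL_commute (ht : a + d ≠ 0) {N : GL (Fin 2) ℤ}
    (hN : ofGL N * el a b c d h = el a b c d h * ofGL N) :
    N * gl2 a b c d h = gl2 a b c d h * N := by
  rw [el, ← map_mul, ← map_mul, ofGL_eq_iff] at hN
  refine hN.resolve_right fun e => ht ?_
  have e : N.1 * !![a, b; c, d] = -(!![a, b; c, d] * N.1) := congrArg Units.val e
  have e0 := congrFun (congrFun e 0) 0
  have e1 := congrFun (congrFun e 0) 1
  have e2 := congrFun (congrFun e 1) 0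
  have e3 := congrFun (congrFun e 1) 1
  simp [-Matrix.cons_mul, Matrix.mul_apply, Fin.sum_univ_two] at e0 e1 e2 e3
  have hdet : N.1 0 0 * N.1 1 1 - N.1 0 1 * N.1 1 0 ≠ 0 := by
    rw [← Matrix.det_fin_two]
    exact ((Matrix.isUnit_iff_isUnit_det _).1 N.isUnit).ne_zero
  -- This is the trace of adj(N)(NM + MN), where M is the matrix of the element; it equals 2 det N
  -- tr M.
  have : 2 * (N.1 0 0 * N.1 1 1 - N.1 0 1 * N.1 1 0) * (a + d) = 0 := by
    linear_combination N.1 1 1 * e0 - N.1 0 1 * e2 - N.1 1 0 * e1 + N.1 0 0 * e3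
  simpa [hdet] using this

/-- The commutant shares a real eigenvector, so log|eigenvalue| is a homomorphism to ℝ. Its kernel
is `±1` because the eigenvector is irrational, and its image is discrete because eigenvalues of
modulus above 1 are at least 3/2; the centralizer modulo sign is therefore cyclic. -/
theorem hasCyclicCentralizer_of_not_isSquare (ht : a + d ≠ 0)
    (hD : 0 < (a - d) ^ 2 + 4 * b * c) (hsq : ¬ IsSquare ((a - d) ^ 2 + 4 * b * c)) :
    HasCyclicCentralizer (el a b c d h) := by
  have hb : b ≠ 0 := by
    rintro rfl
    exact hsq ⟨a - d, by ring⟩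
  have hb' : (b : ℝ) ≠ 0 := by exact_mod_cast hb
  obtain ⟨κ, hκ⟩ : ∃ κ : ℝ, b * κ ^ 2 + (a - d) * κ - c = 0 := by
    have hD' : (0 : ℝ) ≤ (a - d) ^ 2 + 4 * b * c := by exact_mod_cast hD.le
    obtain ⟨s, hs⟩ : ∃ s : ℝ, s ^ 2 = (a - d) ^ 2 + 4 * b * c := ⟨_, Real.sq_sqrt hD'⟩
    refine ⟨(d - a + s) / (2 * b), ?_⟩
    field_simp
    linear_combination hs
  let C := Subgroup.centralizer {gl2 a b c d h}
  let ev : C →* ℝ := commutantEigenvalue hb hκ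
  have hev : ∀ N : C, ev N = N.1.1 0 0 + N.1.1 0 1 * κ := fun _ => rfl
  have hev0 : ∀ N, ev N ≠ 0 := fun N =>
    (IsUnit.map ev (Group.isUnit N)).ne_zero
  let ℓ : Additive C →+ ℝ := AddMonoidHom.mk' (fun N => Real.log |ev N.toMul|) fun N N' => by
    rw [toMul_add, map_mul, abs_mul, Real.log_mul (abs_ne_zero.2 (hev0 _)) (abs_ne_zero.2 (hev0 _))]
  have hℓ : ∀ N : C, ℓ (Additive.ofMul N) = Real.log |ev N| := fun _ => rfl
  have hroot : ∀ N : C, ev N ^ 2 - (N.1.1 0 0 + N.1.1 1 1 : ℤ) * ev N + (N.1.1.det : ℤ) = 0 := by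
    rintro ⟨N, hN⟩
    obtain ⟨e₁, e₂⟩ := entries_of_commute_gl2
      (Subgroup.mem_centralizer_singleton_iff.1 hN)
    have e₁' : (N.1 0 1 * c : ℝ) = b * N.1 1 0 := by exact_mod_cast e₁
    have e₂' : (b * (N.1 1 1 - N.1 0 0) : ℝ) = N.1 0 1 * (d - a) := by exact_mod_cast e₂
    rw [hev, Matrix.det_fin_two]
    push_cast
    refine mul_left_cancel₀ hb' ?_
    linear_combination (N.1 0 1 ^ 2 : ℝ) * hκ + N.1 0 1 * e₁' - N.1 0 1 * κ * e₂'
  have hker : ∀ N : C, ℓ (Additive.ofMul N) = 0 → ofGL N.1 = 1 := by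
    rintro ⟨N, hN⟩ h0
    obtain ⟨e₁, e₂⟩ := entries_of_commute_gl2
      (Subgroup.mem_centralizer_singleton_iff.1 hN)
    have h1 : |ev ⟨N, hN⟩| = 1 :=
      Real.eq_one_of_pos_of_log_eq_zero (abs_pos.2 (hev0 _)) h0
    obtain ⟨ε, hε, hε'⟩ : ∃ ε : ℤ, (ε = 1 ∨ ε = -1) ∧ (N.1 0 0 + N.1 0 1 * κ : ℝ) = ε := by
      rcases (abs_eq zero_le_one).1 h1 with e | e
      · exact ⟨1, Or.inl rfl, by rw [hev] at e; simpa using e⟩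
      · exact ⟨-1, Or.inr rfl, by rw [hev] at e; simpa using e⟩
    have hq : N.1 0 1 = 0 := by
      by_contra hq
      apply hsq
      -- An eigenvalue ±1 with nonzero upper right entry would make κ rational, hence the
      -- discriminant a square.
      have key : (2 * b * (ε - N.1 0 0) + (a - d) * N.1 0 1) ^ 2 =
          N.1 0 1 ^ 2 * ((a - d) ^ 2 + 4 * b * c) := by
        have : (2 * b * (ε - N.1 0 0) + (a - d) * N.1 0 1 : ℝ) ^ 2 =
            N.1 0 1 ^ 2 * ((a - d) ^ 2 + 4 * b * c) := by
          rw [← hε']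
          linear_combination (4 * b * N.1 0 1 ^ 2 : ℝ) * hκ
        exact_mod_cast this
      obtain ⟨k, hk⟩ := (Int.pow_dvd_pow_iff two_ne_zero).1 (Dvd.intro _ key.symm)
      refine ⟨k, mul_left_cancel₀ (pow_ne_zero 2 hq) ?_⟩
      rw [← key, hk]; ring
    rw [hq] at e₁ e₂ hε'
    have hp : N.1 0 0 = ε := by simpa using hε'
    have hr : N.1 1 0 = 0 := by simpa [hb] using e₁
    have hu : N.1 1 1 = ε := by
      have : N.1 1 1 - N.1 0 0 = 0 := by simpa [hb] using e₂
      linarith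
    rw [ofGL_eq_one_iff, Units.ext_iff, Units.ext_iff, Units.val_neg, N.1.eta_fin_two, hp, hq, hr,
      hu, Units.val_one, Matrix.one_fin_two]
    rcases hε with rfl | rfl
    · left; rfl
    · right; simp
  have hgap : ∀ N : C, 0 < ℓ (Additive.ofMul N) → Real.log (3 / 2) ≤ ℓ (Additive.ofMul N) := by
    intro N h0
    rw [hℓ] at h0 ⊢
    have h1 : 1 < |ev N| := (Real.log_pos_iff (abs_nonneg _)).1 h0
    exact Real.log_le_log (by norm_num) (three_halves_le_of_root
      (Int.isUnit_iff.1 ((Matrix.isUnit_iff_isUnit_det _).1 N.1.isUnit)) (hroot N) h1)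
  constructor
  · intro hfin
    obtain ⟨n, hn, e⟩ := isOfFinOrder_iff_pow_eq_one.1 hfin
    let M : C := ⟨gl2 a b c d h, Subgroup.mem_centralizer_singleton_iff.2 rfl⟩
    have hMn : ℓ (Additive.ofMul (M ^ n)) = 0 := by
      rw [el, ← map_pow, ofGL_eq_one_iff] at e
      rw [hℓ, hev]
      have hM : (M ^ n).1 = gl2 a b c d h ^ n := rfl
      rw [hM]
      rcases e with e | e <;> rw [e] <;> simp
    -- Finite order puts the matrix itself in the kernel, so it would be `±1`, contrary to b ≠ 0.
    rw [ofMul_pow, map_nsmul, smul_eq_zero] at hMn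
    have := hker M (hMn.resolve_left hn.ne')
    change el a b c d h = 1 at this
    rw [el_eq_one_iff] at this
    omega
  · obtain ⟨e, he⟩ := AddSubgroup.cyclic_of_isolated_zero (H := ℓ.range) (a := Real.log (3 / 2))
      (Real.log_pos (by norm_num)) (by
        rw [Set.disjoint_left]
        rintro _ ⟨N, rfl⟩ ⟨h1, h2⟩
        exact absurd (hgap N.toMul h1) (not_le.2 h2))
    obtain ⟨N₀, hN₀⟩ : e ∈ ℓ.range := he ▸ AddSubgroup.mem_closure_singleton_self e
    refine ⟨ofGL N₀.toMul.1, fun g => ⟨fun hg => ?_, ?_⟩⟩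
    · obtain ⟨N, rfl⟩ := ofGL_surjective g
      let N' : C := ⟨N, Subgroup.mem_centralizer_singleton_iff.2 (commute_of_ofGL_commute ht hg)⟩
      have hm : ℓ (Additive.ofMul N') ∈ ℓ.range := ⟨_, rfl⟩
      rw [he, AddSubgroup.mem_closure_singleton] at hm
      obtain ⟨k, hk⟩ := hm
      refine ⟨k, ?_⟩
      have := hker (N' * (N₀.toMul ^ k)⁻¹) (by
        rw [ofMul_mul, ofMul_inv, ofMul_zpow, map_add, map_neg, map_zsmul, ofMul_toMul, hN₀, hk,
          add_neg_cancel])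
      have e1 : ofGL (N' * (N₀.toMul ^ k)⁻¹ : C).1 = ofGL N * (ofGL N₀.toMul.1 ^ k)⁻¹ := by
        simp [N']
      rw [e1, mul_inv_eq_one] at this
      exact this.symm
    · rintro ⟨k, rfl⟩
      have hc := Subgroup.mem_centralizer_singleton_iff.1 (N₀.toMul ^ k).2
      have := congrArg ofGL hc
      simpa [el] using this

/-- The classification of the elements of the group. -/
theorem classification (F : NielsenGroup) :
    F = 1 ∨ IsDihedralRotation 2 F ∨ IsDihedralRotation 3 F ∨ HasCyclicCentralizer F := by
  obtain ⟨a, b, c, d, h, rfl⟩ := exists_eq_el F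
  have hyp : a + d ≠ 0 → 0 < (a - d) ^ 2 + 4 * b * c → ¬ IsSquare ((a - d) ^ 2 + 4 * b * c) →
      HasCyclicCentralizer (el a b c d h) := hasCyclicCentralizer_of_not_isSquare
  by_cases ht : a + d = 0
  · right; left
    rcases h with h' | h'
    · exact isDihedralRotation_two_of_trace_zero_of_det_one ht h'
    · exact isDihedralRotation_two_of_trace_zero_of_det_neg_one ht h'
  rcases h with h' | h'
  · have e : (a - d) ^ 2 + 4 * b * c = (a + d) ^ 2 - 4 := by linear_combination -4 * h'
    by_cases h3 : 3 ≤ |a + d|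
    · right; right; right
      refine hyp ht ?_ ?_
      · rw [e, ← sq_abs]; nlinarith
      · rw [e]; exact not_isSquare_sq_sub_four h3
    · have : a + d = 1 ∨ a + d = 2 ∨ -a + -d = 1 ∨ -a + -d = 2 := by
        rw [not_le, abs_lt] at h3; omega
      rcases this with h1 | h2 | h1 | h2
      · exact Or.inr (Or.inr (Or.inl (isDihedralRotation_three_of_trace_one h1 h')))
      · exact (eq_one_or_hasCyclicCentralizer_of_trace_two h2 h').imp_right
          fun h => Or.inr (Or.inr h)
      · rw [el_neg]
        exact Or.inr (Or.inr (Or.inl (isDihedralRotation_three_of_trace_one h1 (by linarith))))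
      · rw [el_neg]
        exact (eq_one_or_hasCyclicCentralizer_of_trace_two h2 (by linarith)).imp_right
          fun h => Or.inr (Or.inr h)
  · have e : (a - d) ^ 2 + 4 * b * c = (a + d) ^ 2 + 4 := by linear_combination -4 * h'
    right; right; right
    refine hyp ht ?_ ?_
    · rw [e]; positivity
    · rw [e]; exact not_isSquare_sq_add_four ht

end NielsenGroup

/-! ### From centralizers to reversing symmetry groups -/

section Group

variable {Γ : Type*} [Group Γ] {F : Γ}

theorem HasCyclicCentralizer.ne_one (h : HasCyclicCentralizer F) : F ≠ 1 := by
  rintro rfl; exact h.1 IsOfFinOrder.one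

theorem HasCyclicCentralizer.exists_mem_zpowers (h : HasCyclicCentralizer F) :
    ∃ c : Γ, orderOf c = 0 ∧ F ∈ Subgroup.zpowers c ∧
      ∀ g, g * F = F * g ↔ g ∈ Subgroup.zpowers c := by
  obtain ⟨hF, c, hc⟩ := h
  have hFc : F ∈ Subgroup.zpowers c := (hc F).1 rfl
  refine ⟨c, orderOf_eq_zero fun hfin => hF ?_, hFc, hc⟩
  exact hfin.of_mem_zpowers hFc

theorem HasCyclicCentralizer.nonempty_mulEquiv_cyclicInf (h : HasCyclicCentralizer F)
    (hr : ¬ IsReversible F) : Nonempty (reversingSymmetryGroup F ≃* CyclicInf) := by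
  obtain ⟨c, hc0, -, hc⟩ := h.exists_mem_zpowers
  have hinj : Function.Injective (zpowersHom Γ c) := by
    intro m n hmn
    exact injective_zpow_iff_not_isOfFinOrder.2 (orderOf_eq_zero_iff.1 hc0) hmn
  have hrange : (zpowersHom Γ c).range = reversingSymmetryGroup F := by
    ext g
    rw [mem_reversingSymmetryGroup, or_iff_left fun e => hr ⟨g, e⟩, mul_inv_eq_iff_eq_mul, hc]
    rfl
  exact ⟨((MonoidHom.ofInjective hinj).trans (MulEquiv.subgroupCongr hrange)).symm⟩

/-- The rotation subgroup is the whole centralizer ⟨c⟩, which may exceed ⟨F⟩. Since F = c^m with m ≠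
0, inverting F forces a reverser s to invert c. Then s² is a power of c that s both fixes and
inverts, so s² = 1. -/
theorem HasCyclicCentralizer.nonempty_mulEquiv_dihedralInf (h : HasCyclicCentralizer F)
    (hr : IsReversible F) : Nonempty (reversingSymmetryGroup F ≃* DihedralInf) := by
  obtain ⟨c, hc0, ⟨m, hm⟩, hc⟩ := h.exists_mem_zpowers
  have hm : c ^ m = F := hm
  obtain ⟨s, hs⟩ := hr
  have hinj : Function.Injective fun n : ℤ => c ^ n :=
    injective_zpow_iff_not_isOfFinOrder.2 (orderOf_eq_zero_iff.1 hc0)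
  have hm0 : m ≠ 0 := by
    rintro rfl; exact h.ne_one (by rw [← hm, zpow_zero])
  have hcomm : ∀ g, g * F * g⁻¹ = F ↔ g ∈ Subgroup.zpowers c := fun g => by
    rw [mul_inv_eq_iff_eq_mul, hc]
  -- `s` normalizes the centralizer `⟨c⟩`, and acts on it as it does on `F`
  obtain ⟨k, hk⟩ : s * c * s⁻¹ ∈ Subgroup.zpowers c := by
    rw [← hcomm]
    have h1 : s⁻¹ * F * s = F⁻¹ := by
      calc s⁻¹ * F * s = (s⁻¹ * F⁻¹ * s)⁻¹ := by group
        _ = (s⁻¹ * (s * F * s⁻¹) * s)⁻¹ := by rw [hs]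
        _ = F⁻¹ := by group
    have h2 : c * F * c⁻¹ = F := (hcomm c).2 (Subgroup.mem_zpowers c)
    rw [show s * c * s⁻¹ * F * (s * c * s⁻¹)⁻¹ = s * (c * (s⁻¹ * F * s) * c⁻¹) * s⁻¹ by group, h1,
      show c * F⁻¹ * c⁻¹ = (c * F * c⁻¹)⁻¹ by group, h2, show s * F⁻¹ * s⁻¹ = (s * F * s⁻¹)⁻¹ by
      group, hs, inv_inv]
  have hk : c ^ k = s * c * s⁻¹ := hk
  have hk1 : k = -1 := by
    have h1 : c ^ (k * m) = c ^ (-m) := by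
      rw [zpow_mul, hk, conj_zpow, hm, hs, zpow_neg, hm]
    have := hinj h1
    exact mul_right_cancel₀ hm0 (by linarith)
  rw [hk1, zpow_neg_one] at hk
  have hs2 : s * s = 1 := by
    obtain ⟨n, hn⟩ : s * s ∈ Subgroup.zpowers c := by
      rw [← hcomm, show s * s * F * (s * s)⁻¹ = s * (s * F * s⁻¹) * s⁻¹ by group, hs,
        show s * F⁻¹ * s⁻¹ = (s * F * s⁻¹)⁻¹ by group, hs, inv_inv]
    have hn : c ^ n = s * s := hn
    have h1 : c ^ (-n) = c ^ n := by
      rw [zpow_neg, ← inv_zpow, hk, conj_zpow, hn]; group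
    have : -n = n := hinj h1
    have : n = 0 := by omega
    rw [← hn, this, zpow_zero]
  have hns : s ∉ Subgroup.zpowers c := fun hmem => by
    have h1 : F = F⁻¹ := ((hcomm s).2 hmem).symm.trans hs
    exact h.1 (isOfFinOrder_iff_pow_eq_one.2 ⟨2, two_pos, by
      rw [pow_two]; exact mul_eq_one_iff_eq_inv.2 h1⟩)
  have := nonempty_mulEquiv_dihedralGroup (reversingSymmetryGroup F) hs2 hk.symm hns fun g => by
    rw [mem_reversingSymmetryGroup, hcomm]
    refine or_congr_right ?_
    rw [← hcomm, show g * s * F * (g * s)⁻¹ = g * (s * F * s⁻¹) * g⁻¹ by group, hs,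
      show g * F⁻¹ * g⁻¹ = (g * F * g⁻¹)⁻¹ by group, inv_eq_iff_eq_inv]
  rwa [hc0] at this

theorem IsDihedralRotation.orderOf_eq {p : ℕ} [Fact p.Prime] (h : IsDihedralRotation p F) :
    orderOf F = p :=
  orderOf_eq_prime h.1 h.2.1

theorem IsDihedralRotation.nonempty_mulEquiv {p : ℕ} [Fact p.Prime]
    (h : IsDihedralRotation p F) : Nonempty (reversingSymmetryGroup F ≃* DihedralGroup p) :=
  h.orderOf_eq ▸ h.2.2.nonempty_mulEquiv

theorem reversingSymmetryGroup_one : reversingSymmetryGroup (1 : Γ) = ⊤ := by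
  rw [eq_top_iff]
  rintro g -
  left; group

end Group

/-! ### Separating the five groups, and the theorem -/

/-- The five groups are told apart by the existence of elements of order 2 and 3 and by finiteness;
this supplies one of the torsion facts. -/
theorem dihedralInf_pow_three_eq_one {x : DihedralInf} (hx : x ^ 3 = 1) : x = 1 := by
  rcases x with i | i
  · rw [DihedralGroup.r_pow, DihedralGroup.one_def] at hx
    -- Stated over ℤ, to which `ZMod 0` reduces by definition, so that integer arithmetic applies to
    -- i.
    have h3 : ∀ j : ℤ, j * 3 = 0 → j = 0 := by intro j; omega
    have h0 : i = 0 := h3 i (DihedralGroup.r.inj hx)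
    rw [h0]; rfl
  · rw [pow_succ, pow_two, DihedralGroup.sr_mul_self, one_mul] at hx
    exact absurd hx (by rw [DihedralGroup.one_def]; nofun)

theorem dihedralTwo_pow_three_eq_one {x : DihedralGroup 2} (hx : x ^ 3 = 1) : x = 1 := by
  revert x; decide

theorem cyclicInf_pow_eq_one {n : ℕ} (hn : n ≠ 0) {x : CyclicInf} (hx : x ^ n = 1) : x = 1 := by
  have : n • x.toAdd = 0 := hx
  have := (smul_eq_zero.1 this).resolve_left hn
  exact this

namespace NielsenGroup

theorem exists_pow_three_eq_one_ne_one : ∃ u : NielsenGroup, u ^ 3 = 1 ∧ u ≠ 1 := by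
  refine ⟨el 0 (-1) 1 1 (by norm_num), ?_, ?_⟩
  · rw [pow_succ, pow_two, el_mul, el_mul, el_eq_one_iff]; norm_num
  · rw [ne_eq, el_eq_one_iff]; norm_num

theorem exists_not_isOfFinOrder : ∃ u : NielsenGroup, ¬ IsOfFinOrder u :=
  ⟨_, (hasCyclicCentralizer_unipotent one_ne_zero).1⟩

end NielsenGroup

theorem theorem2 :
    -- every polynomial mapping in the defining set is invertible in it, so the set is a group
    (∀ F : nielsenMaps, IsUnit F) ∧
    Nonempty (DihedralGroup 2 ≃* CyclicTwo × CyclicTwo) ∧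
    ∀ F : NielsenGroup,
      -- one of the five cases occurs
      ((¬ IsReversible F ∧ Nonempty (reversingSymmetryGroup F ≃* CyclicInf)) ∨
        (F = 1 ∧ reversingSymmetryGroup F = ⊤) ∨
        ((F ^ 2 = 1 ∧ F ≠ 1) ∧ Nonempty (reversingSymmetryGroup F ≃* DihedralGroup 2)) ∨
        ((F ^ 3 = 1 ∧ F ≠ 1) ∧ Nonempty (reversingSymmetryGroup F ≃* DihedralGroup 3)) ∨
        ((IsTrulyReversible F ∧ ¬ IsOfFinOrder F) ∧
          Nonempty (reversingSymmetryGroup F ≃* DihedralInf))) ∧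
      -- the group determines the case and conversely
      (Nonempty (reversingSymmetryGroup F ≃* CyclicInf) ↔ ¬ IsReversible F) ∧
      (reversingSymmetryGroup F = ⊤ ↔ F = 1) ∧
      (Nonempty (reversingSymmetryGroup F ≃* NielsenGroup) ↔ F = 1) ∧
      (Nonempty (reversingSymmetryGroup F ≃* DihedralGroup 2) ↔ F ^ 2 = 1 ∧ F ≠ 1) ∧
      (Nonempty (reversingSymmetryGroup F ≃* DihedralGroup 3) ↔ F ^ 3 = 1 ∧ F ≠ 1) ∧
      (IsTrulyReversible F → ¬ IsOfFinOrder F →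
        Nonempty (reversingSymmetryGroup F ≃* DihedralInf)) ∧
      (IsOfFinOrder F → IsReversible F) := by
  refine ⟨NielsenGroup.isUnit, ?_, fun F => ?_⟩
  · have : IsKleinFour (CyclicTwo × CyclicTwo) := ⟨by simp, by
      rw [Monoid.exponent_prod]; simp [Monoid.exponent_multiplicative, ZMod.exponent]⟩
    exact IsKleinFour.nonempty_mulEquiv
  have : Fact (Nat.Prime 2) := ⟨Nat.prime_two⟩
  have : Fact (Nat.Prime 3) := ⟨Nat.prime_three⟩
  -- the five possible groups are pairwise not isomorphic
  have transport : ∀ {A B : Type} [Group A] [Group B], (A ≃* B) → ∀ {n : ℕ},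
      (∀ x : A, x ^ n = 1 → x = 1) → ∀ x : B, x ^ n = 1 → x = 1 := by
    intro A B _ _ e n hA x hx
    have := hA (e.symm x) (by rw [← map_pow, hx, map_one])
    simpa using this
  have c2 : ∀ x : CyclicInf, x ^ 2 = 1 → x = 1 := fun x => cyclicInf_pow_eq_one two_ne_zero
  have c3 : ∀ x : CyclicInf, x ^ 3 = 1 → x = 1 := fun x => cyclicInf_pow_eq_one three_ne_zero
  have dinf3 : ∀ x : DihedralInf, x ^ 3 = 1 → x = 1 := fun x => dihedralInf_pow_three_eq_one
  have d23 : ∀ x : DihedralGroup 2, x ^ 3 = 1 → x = 1 := fun x => dihedralTwo_pow_three_eq_one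
  have nd : ∀ n, ¬ ∀ x : DihedralGroup n, x ^ 2 = 1 → x = 1 := fun n h =>
    absurd (h (.sr 0) (by rw [pow_two, DihedralGroup.sr_mul_self]))
      (by rw [DihedralGroup.one_def]; nofun)
  have nd3 : ¬ ∀ x : DihedralGroup 3, x ^ 3 = 1 → x = 1 := by decide
  have nG3 : ¬ ∀ x : NielsenGroup, x ^ 3 = 1 → x = 1 := by
    obtain ⟨u, hu, hu1⟩ := NielsenGroup.exists_pow_three_eq_one_ne_one
    exact fun h => hu1 (h u hu)
  have nGfin : ¬ Finite NielsenGroup := fun _ => by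
    obtain ⟨u, hu⟩ := NielsenGroup.exists_not_isOfFinOrder
    exact hu (isOfFinOrder_of_finite u)
  have ninf : ¬ Finite DihedralInf := not_finite_iff_infinite.2 inferInstance
  have nGD3 : IsEmpty (NielsenGroup ≃* DihedralGroup 3) :=
    ⟨fun e => nGfin (Finite.of_equiv _ e.symm.toEquiv)⟩
  rcases NielsenGroup.classification F with rfl | h2 | h3 | hinf
  · have e : reversingSymmetryGroup (1 : NielsenGroup) ≃* NielsenGroup :=
      (MulEquiv.subgroupCongr reversingSymmetryGroup_one).trans Subgroup.topEquiv
    have hrev : IsReversible (1 : NielsenGroup) := ⟨1, by group⟩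
    refine ⟨Or.inr (Or.inl ⟨rfl, reversingSymmetryGroup_one⟩), ?_, ?_, ?_, ?_, ?_, ?_, ?_⟩
    · exact ⟨fun ⟨f⟩ => absurd (transport (f.symm.trans e) c3) nG3, fun h => absurd hrev h⟩
    · exact ⟨fun _ => rfl, fun _ => reversingSymmetryGroup_one⟩
    · exact ⟨fun _ => rfl, fun _ => ⟨e⟩⟩
    · exact ⟨fun ⟨f⟩ => absurd (transport (f.symm.trans e) d23) nG3, fun h => absurd rfl h.2⟩
    · exact ⟨fun ⟨f⟩ => (nGD3.false (e.symm.trans f)).elim, fun h => absurd rfl h.2⟩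
    · exact fun h => absurd (one_pow 2) h.2
    · exact fun _ => hrev
  · obtain ⟨e⟩ := h2.nonempty_mulEquiv
    have hrev := h2.2.2.isReversible
    refine ⟨Or.inr (Or.inr (Or.inl ⟨⟨h2.1, h2.2.1⟩, ⟨e⟩⟩)), ?_, ?_, ?_, ?_, ?_, ?_, ?_⟩
    · exact ⟨fun ⟨f⟩ => absurd (transport (f.symm.trans e) c2) (nd 2), fun h => absurd hrev h⟩
    · refine ⟨fun h => absurd (transport (e.symm.trans ((MulEquiv.subgroupCongr h).trans
        Subgroup.topEquiv)) d23) nG3, fun h => absurd h h2.2.1⟩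
    · exact ⟨fun ⟨f⟩ => absurd (transport (e.symm.trans f) d23) nG3, fun h => absurd h h2.2.1⟩
    · exact ⟨fun _ => ⟨h2.1, h2.2.1⟩, fun _ => ⟨e⟩⟩
    · refine ⟨fun ⟨f⟩ => absurd (transport (e.symm.trans f) d23) nd3, fun h => absurd ?_ h2.2.1⟩
      rw [← h.1, pow_succ, h2.1, one_mul]
    · exact fun h => absurd h2.1 h.2
    · exact fun _ => hrev
  · obtain ⟨e⟩ := h3.nonempty_mulEquiv
    have hrev := h3.2.2.isReversible
    have hfin : IsOfFinOrder F := isOfFinOrder_iff_pow_eq_one.2 ⟨3, three_pos, h3.1⟩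
    refine ⟨Or.inr (Or.inr (Or.inr (Or.inl ⟨⟨h3.1, h3.2.1⟩, ⟨e⟩⟩))), ?_, ?_, ?_, ?_, ?_, ?_, ?_⟩
    · exact ⟨fun ⟨f⟩ => absurd (transport (f.symm.trans e) c3) nd3, fun h => absurd hrev h⟩
    · refine ⟨fun h => (nGD3.false (((MulEquiv.subgroupCongr h).trans
        Subgroup.topEquiv).symm.trans e)).elim, fun h => absurd h h3.2.1⟩
    · exact ⟨fun ⟨f⟩ => (nGD3.false (f.symm.trans e)).elim, fun h => absurd h h3.2.1⟩
    · refine ⟨fun ⟨f⟩ => absurd (transport (f.symm.trans e) d23) nd3, fun h => absurd ?_ h3.2.1⟩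
      rw [← h3.1, pow_succ, h.1, one_mul]
    · exact ⟨fun _ => ⟨h3.1, h3.2.1⟩, fun _ => ⟨e⟩⟩
    · exact fun _ h => absurd hfin h
    · exact fun _ => hrev
  · have hne := hinf.ne_one
    have npow : ∀ n ≠ 0, F ^ n ≠ 1 := fun n hn e =>
      hinf.1 (isOfFinOrder_iff_pow_eq_one.2 ⟨n, Nat.pos_of_ne_zero hn, e⟩)
    by_cases hrev : IsReversible F
    · obtain ⟨e⟩ := hinf.nonempty_mulEquiv_dihedralInf hrev
      refine ⟨Or.inr (Or.inr (Or.inr (Or.inr ⟨⟨⟨hrev, npow 2 two_ne_zero⟩, hinf.1⟩, ⟨e⟩⟩))),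
        ?_, ?_, ?_, ?_, ?_, ?_, ?_⟩
      · exact ⟨fun ⟨f⟩ => absurd (transport (f.symm.trans e) c2) (nd 0), fun h => absurd hrev h⟩
      · exact ⟨fun h => absurd (transport (e.symm.trans ((MulEquiv.subgroupCongr h).trans
          Subgroup.topEquiv)) dinf3) nG3, fun h => absurd h hne⟩
      · exact ⟨fun ⟨f⟩ => absurd (transport (e.symm.trans f) dinf3) nG3, fun h => absurd h hne⟩
      · exact ⟨fun ⟨f⟩ => absurd (Finite.of_equiv _ (f.symm.trans e).toEquiv) ninf,
          fun h => absurd h.1 (npow 2 two_ne_zero)⟩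
      · exact ⟨fun ⟨f⟩ => absurd (transport (e.symm.trans f) dinf3) nd3,
          fun h => absurd h.1 (npow 3 three_ne_zero)⟩
      · exact fun _ _ => ⟨e⟩
      · exact fun h => absurd h hinf.1
    · obtain ⟨e⟩ := hinf.nonempty_mulEquiv_cyclicInf hrev
      refine ⟨Or.inl ⟨hrev, ⟨e⟩⟩, ?_, ?_, ?_, ?_, ?_, ?_, ?_⟩
      · exact ⟨fun _ => hrev, fun _ => ⟨e⟩⟩
      · exact ⟨fun h => absurd (transport (e.symm.trans ((MulEquiv.subgroupCongr h).trans
          Subgroup.topEquiv)) c3) nG3, fun h => absurd h hne⟩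
      · exact ⟨fun ⟨f⟩ => absurd (transport (e.symm.trans f) c3) nG3, fun h => absurd h hne⟩
      · exact ⟨fun ⟨f⟩ => absurd (transport (e.symm.trans f) c2) (nd 2),
          fun h => absurd h.1 (npow 2 two_ne_zero)⟩
      · exact ⟨fun ⟨f⟩ => absurd (transport (e.symm.trans f) c2) (nd 3),
          fun h => absurd h.1 (npow 3 three_ne_zero)⟩
      · exact fun h => absurd h.1 hrev
      · exact fun h => absurd h hinf.1
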